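/- Let $p$ be a prime number and let $R$ be a commutative ring of characteristic $p$. For an $R$-module $M$ and an integer $e\ge 0$ let $F^e_*M$ denote the abelian group $M$ on which $x\in R$ acts as multiplication by $x^{p^e}$. Suppose that $R$ is $F$-finite, i.e. $R$ is noetherian and $F^1_*R$ is a finitely generated $R$-module, and that $R$ has complete local finite $F$-representation type (CL-FFRT), i.e. for every prime ideal $\mathfrak p\subseteq R$ the completion $S=\widehat{R_{\mathfrak p}}$ of the local ring $R_{\mathfrak p}$ has finite $F$-representation type: there are finitely many finitely generated indecomposable $S$-modules $M_1,\dots,M_s$ such that for every $e\ge 0$ there are integers $n_{1,e},\dots,n_{s,e}\ge 0$ with $F^e_*S\cong M_1^{\oplus n_{1,e}}\oplus\cdots\oplus M_s^{\oplus n_{s,e}}$ as $S$-modules. Let $I_1,\dots,I_r\subseteq R$ be ideals and let $i_1,\dots,i_r\ge 0$ be integers, and write $H^i_I(-)=\varinjlim_t \operatorname{Ext}^i_R(R/I^t,-)$ for the $i$-th local cohomology functor with support in $I$. Then the iterated local cohomology module $$\bigl(H^{i_1}_{I_1}\circ\cdots\circ H^{i_r}_{I_r}\bigr)(R)$$ has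 only finitely many associated primes. -/

import Mathlib

open CategoryTheory

universe u

/-- A nonzero ring that receives a ring homomorphism from a ring of prime characteristic `p` has
characteristic `p`. -/
theorem charP_of_ringHom_of_prime (p : ℕ) [hp : Fact p.Prime] {A : Type u} {B : Type u}
    [CommRing A] [CommRing B] [Nontrivial B] [CharP A p] (f : A →+* B) : CharP B p := by
  refine (CharP.charP_iff_prime_eq_zero hp.out).2 ?_
  rw [← map_natCast f, CharP.cast_eq_zero, map_zero]

/-- The `e`-th Frobenius pushforward `F^e_* M`: the abelian group `M` on which `x : R` acts as
`x ^ p ^ e` (restriction of scalars along the `e`-th iterate of the Frobenius). -/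
noncomputable def frobeniusPushforward (p : ℕ) [Fact p.Prime] {R : Type u} [CommRing R] [CharP R p]
    (e : ℕ) (M : ModuleCat.{u} R) : ModuleCat.{u} R :=
  (ModuleCat.restrictScalars (iterateFrobenius R p e)).obj M

/-- A ring of characteristic `p` is `F`-finite if it is noetherian and `F_* R` is a finitely
generated `R`-module. -/
structure IsFFinite (p : ℕ) [Fact p.Prime] (R : Type u) [CommRing R] [CharP R p] : Prop where
  isNoetherianRing : IsNoetherianRing R
  finite_pushforward : Module.Finite R (frobeniusPushforward p 1 (ModuleCat.of R R))

/-- An indecomposable module: it is nonzero, and whenever it is the internal direct sum of two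
submodules, one of them is zero. -/
structure IsIndecomposableModule (R : Type u) [CommRing R] (M : Type u) [AddCommGroup M]
    [Module R M] : Prop where
  nontrivial : Nontrivial M
  eq_bot_or_eq_bot : ∀ A B : Submodule R M, IsCompl A B → A = ⊥ ∨ B = ⊥

/-- Finite `F`-representation type, for a complete local `F`-finite ring `S`: there are finitely
many finitely generated indecomposable modules `M₁, …, Mₛ` such that each `F^e_* S`, `e ≥ 0`, is
isomorphic to `M₁ ^ n₁ ⊕ ⋯ ⊕ Mₛ ^ nₛ` for some `n₁, …, nₛ ≥ 0` (depending on `e`). -/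
def HasFFRT (p : ℕ) [Fact p.Prime] (S : Type u) [CommRing S] [CharP S p] : Prop :=
  ∃ (s : ℕ) (M : Fin s → ModuleCat.{u} S),
    (∀ i, Module.Finite S (M i) ∧ IsIndecomposableModule S (M i)) ∧
    ∀ e : ℕ, ∃ n : Fin s → ℕ,
      Nonempty (frobeniusPushforward p e (ModuleCat.of S S) ≃ₗ[S]
        ((i : Fin s) → Fin (n i) → M i))

/-- The completion of the local ring `R_𝔭` with respect to its maximal ideal. -/
abbrev CompletedLocalization {R : Type u} [CommRing R] (𝔭 : Ideal R) [𝔭.IsPrime] : Type u :=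
  AdicCompletion (IsLocalRing.maximalIdeal (Localization.AtPrime 𝔭)) (Localization.AtPrime 𝔭)

instance CompletedLocalization.instCharP (p : ℕ) [Fact p.Prime] {R : Type u} [CommRing R]
    [CharP R p] (𝔭 : Ideal R) [𝔭.IsPrime] : CharP (CompletedLocalization 𝔭) p := by
  have : Nontrivial (Localization.AtPrime 𝔭 ⧸
      IsLocalRing.maximalIdeal (Localization.AtPrime 𝔭)) :=
    Ideal.Quotient.nontrivial_iff.2 (IsLocalRing.maximalIdeal.isMaximal _).ne_top
  have : Nontrivial (CompletedLocalization 𝔭) :=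
    (AdicCompletion.evalOneₐ
      (IsLocalRing.maximalIdeal (Localization.AtPrime 𝔭))).toRingHom.domain_nontrivial
  exact charP_of_ringHom_of_prime p ((algebraMap (Localization.AtPrime 𝔭)
    (CompletedLocalization 𝔭)).comp (algebraMap R (Localization.AtPrime 𝔭)))

/-- A ring of characteristic `p` has complete local finite `F`-representation type if it is
`F`-finite and, for each prime ideal `𝔭`, the completion of `R_𝔭` has finite `F`-representation
type. -/
structure HasCLFFRT (p : ℕ) [Fact p.Prime] (R : Type u) [CommRing R] [CharP R p] : Prop where
  isFFinite : IsFFinite p R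
  hasFFRT : ∀ (𝔭 : Ideal R) [𝔭.IsPrime], HasFFRT p (CompletedLocalization 𝔭)

/-- The iterated local cohomology functor `H^{i₁}_{I₁} ∘ ⋯ ∘ H^{iᵣ}_{Iᵣ}` attached to the list
`[(I₁, i₁), …, (Iᵣ, iᵣ)]`. -/
noncomputable def iteratedLocalCohomology {R : Type u} [CommRing R] :
    List (Ideal R × ℕ) → (ModuleCat.{u} R ⥤ ModuleCat.{u} R)
  | [] => 𝟭 (ModuleCat.{u} R)
  | (I, i) :: L => iteratedLocalCohomology L ⋙ localCohomology I i

/-!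
The proof rests on two ideas.

*Frobenius compresses local cohomology.* Let `H` be an iterated local cohomology functor. Since the
powers of an ideal `I` and the ideals generated by the Frobenius powers of the `I ^ t` are cofinal,
`H` commutes with the Frobenius pushforwards `F^e_*`. Moreover a class of `H^i_I(M)` represented in
`Ext^i(R ⧸ I ^ t, M)` is carried by `F^e_*`, once `p ^ e ≥ t`, into the image of
`Ext^i(R ⧸ I, F^e_* N)`, where `N` is a finitely generated submodule of `M`. By induction on the
number of functors this gives a functorial submodule `T M ≤ H M`, finitely generated for finitely
generated `M`, such that each `x ∈ H M` lies in `T (F^e_* M)` for all large `e`: this is a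
`FrobeniusApproximation`. All of this is carried out with matrices: `MatrixComplex` is a complex of
finite free modules given by matrices, `MatrixComplex.lcClass` turns its cocycles into classes of
Mathlib's `localCohomology`, and the comparison of `H^i_I` with `F^e_*` reduces to the statement
that the inverse system of homologies of the base changes of the resolutions of `R ⧸ I ^ t` is
pro-zero, which is an Artin–Rees argument.

*Only finitely many `F^e_* R` matter.* For the completion `S` of `R` at a prime `𝔭`, finite
`F`-representation type says that the identity of `F^e_* S` is, for some `e`, a sum of maps factoring
through `F^{e'}_* S` with `e' < e` (`HasFFRT.exists_one_mem_factorsBelow`). By flatness of `S` over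
`R` these maps are combinations, with coefficients in `S`, of maps defined over `R`; approximating
the coefficients by fractions and applying the Cayley–Hamilton theorem, some `c ∉ 𝔭` times the
identity of `F^e_* R` is a sum of maps factoring through `F^{e'}_* R` with `e' < e`
(`exists_mem_factorsBelowIdeal`). The set of such `c` is an ideal that increases with `e`, so that it
is the unit ideal for a large `n` (`HasCLFFRT.exists_factorsBelowIdeal_eq_top`).

Now let `P` be the annihilator of `u ∈ H R`. The image `v` of `u` in `T (F^e_* R)` for large `e` still
has annihilator `P`. If `e ≥ n`, the identity of `F^e_* R` is a sum of maps `β ∘ α` through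
`F^{e'}_* R` with `e' < e`, and `P` is the annihilator of `H(α) v ∈ T (F^{e'}_* R)` for one of these
`α`: otherwise some element outside `P` would kill `v`. Hence `P` is an associated prime of one of the
finitely generated modules `T (F^k_* R)` with `k < n`.
-/

open scoped Matrix

/-! ### Matrices acting on tuples of module elements -/

namespace Matrix

variable {R : Type*} [CommRing R] {l m n : Type*} [Fintype n]
variable {N N' : Type*} [AddCommGroup N] [Module R N] [AddCommGroup N'] [Module R N']

/-- The action of a matrix with entries in `R` on column vectors with entries in an `R`-module. -/
def act (N : Type*) [AddCommGroup N] [Module R N] (A : Matrix m n R) :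
    (n → N) →ₗ[R] (m → N) where
  toFun x i := ∑ j, A i j • x j
  map_add' x y := by
    ext i
    simp [smul_add, Finset.sum_add_distrib]
  map_smul' r x := by
    ext i
    simp [Finset.smul_sum, smul_comm r]

theorem act_apply (A : Matrix m n R) (x : n → N) (i : m) :
    A.act N x i = ∑ j, A i j • x j := rfl

theorem act_mul [Fintype m] (A : Matrix l m R) (B : Matrix m n R) (x : n → N) :
    (A * B).act N x = A.act N (B.act N x) := by
  ext i
  simp only [act_apply, Matrix.mul_apply, Finset.sum_smul, Finset.smul_sum, mul_smul]
  exact Finset.sum_comm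

theorem act_transpose_mul [Fintype m] (A : Matrix n m R) (B : Matrix m l R) (z : n → N) :
    (A * B)ᵀ.act N z = Bᵀ.act N (Aᵀ.act N z) := by
  rw [Matrix.transpose_mul, act_mul]

theorem act_add (A B : Matrix m n R) (x : n → N) :
    (A + B).act N x = A.act N x + B.act N x := by
  ext i
  simp [act_apply, add_smul, Finset.sum_add_distrib]

theorem act_sub (A B : Matrix m n R) (x : n → N) :
    (A - B).act N x = A.act N x - B.act N x := by
  ext i
  simp [act_apply, sub_smul, Finset.sum_sub_distrib]

@[simp]
theorem act_one [DecidableEq n] (x : n → N) : (1 : Matrix n n R).act N x = x := by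
  ext i
  simp [act_apply, Matrix.one_apply, ite_smul]

@[simp]
theorem act_zero (x : n → N) : (0 : Matrix m n R).act N x = 0 := by
  ext i
  simp [act_apply]

/-- The action of matrices is natural in the module. -/
theorem act_comp (A : Matrix m n R) (f : N →ₗ[R] N') (x : n → N) :
    A.act N' (fun j => f (x j)) = fun i => f (A.act N x i) := by
  ext i
  simp [act_apply]

/-- Vectors with entries in a free module are families of vectors with entries in `R`. -/
theorem act_pi {ι : Type*} (A : Matrix m n R) (x : n → ι → R) (k : ι) :
    (fun i => A.act (ι → R) x i k) = A *ᵥ (fun j => x j k) := by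
  ext i
  simp [act_apply, Matrix.mulVec, dotProduct]

end Matrix

/-! ### Complexes of finite free modules given by matrices -/

section MatrixComplex

variable {R : Type*} [CommRing R]

/-- The ranks of a complex of finite free modules whose module in degree `0` is `R` itself. -/
def complexRank (n : ℕ → ℕ) : ℕ → ℕ
  | 0 => 1
  | k + 1 => n k

/-- A chain complex of finite free modules with `R` in degree `0`, given by the matrices of its
differentials. -/
structure MatrixComplex (R : Type*) [CommRing R] where
  /-- the ranks in positive degrees, shifted by one -/
  n : ℕ → ℕ
  /-- the differential from degree `k + 1` to degree `k` -/
  D : ∀ k, Matrix (Fin (complexRank n k)) (Fin (complexRank n (k + 1))) R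
  D_mul_D : ∀ k, D k * D (k + 1) = 0

namespace MatrixComplex

/-- The rank of a complex in degree `k`. -/
abbrev rk (P : MatrixComplex R) (k : ℕ) : ℕ := complexRank P.n k

/-- The complex `P` is a free resolution of `R ⧸ J`. -/
structure IsResolution (P : MatrixComplex R) (J : Ideal R) : Prop where
  exact_zero : ∀ x : Fin 1 → R, x 0 ∈ J ↔ ∃ y, P.D 0 *ᵥ y = x
  exact_succ : ∀ k x, P.D k *ᵥ x = 0 → ∃ y, P.D (k + 1) *ᵥ y = x

/-- Chain maps that are the identity of `R` in degree `0`, given by matrices. -/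
structure Hom (Q P : MatrixComplex R) where
  f : ∀ k, Matrix (Fin (P.rk k)) (Fin (Q.rk k)) R
  comm : ∀ k, f k * Q.D k = P.D k * f (k + 1)
  zero : f 0 = (1 : Matrix (Fin 1) (Fin 1) R)

/-- Base change of a complex along a ring homomorphism: apply it to all matrix entries. -/
def map {S : Type*} [CommRing S] (P : MatrixComplex R) (σ : R →+* S) : MatrixComplex S where
  n := P.n
  D k := (P.D k).map σ
  D_mul_D k := by rw [← Matrix.map_mul, P.D_mul_D, Matrix.map_zero _ (map_zero σ)]

/-- Base change of a chain map along a ring homomorphism. -/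
def Hom.map {S : Type*} [CommRing S] {Q P : MatrixComplex R} (g : Q.Hom P) (σ : R →+* S) :
    (Q.map σ).Hom (P.map σ) where
  f k := (g.f k).map σ
  comm k := by
    change (g.f k).map σ * (Q.D k).map σ = (P.D k).map σ * (g.f (k + 1)).map σ
    rw [← Matrix.map_mul, g.comm, Matrix.map_mul]
  zero := by
    rw [g.zero]
    exact Matrix.map_one _ (map_zero σ) (map_one σ)

/-- Composition of chain maps. -/
def Hom.comp {Q P O : MatrixComplex R} (g : P.Hom O) (h : Q.Hom P) : Q.Hom O where
  f k := g.f k * h.f k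
  comm k := by rw [Matrix.mul_assoc, h.comm, ← Matrix.mul_assoc, g.comm, Matrix.mul_assoc]
  zero := by
    rw [g.zero, h.zero]
    exact Matrix.one_mul _

end MatrixComplex

/-- A matrix whose columns lie in the image of `B` on vectors factors through `B`. -/
theorem Matrix.exists_mul_eq_of_forall_col {l m n : Type*} [Fintype m]
    (B : Matrix l m R) (A : Matrix l n R)
    (h : ∀ j, ∃ y, B *ᵥ y = fun i => A i j) : ∃ C : Matrix m n R, B * C = A := by
  choose y hy using h
  refine ⟨fun i j => y j i, ?_⟩
  ext i j
  exact congrFun (hy j) i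

theorem Matrix.col_mul {l m n : Type*} [Fintype m]
    (B : Matrix l m R) (C : Matrix m n R) (j : n) :
    B *ᵥ (fun i => C i j) = fun i => (B * C) i j := rfl

section Existence

variable [IsNoetherianRing R]

/-- Over a noetherian ring, each submodule of a finite free module is a column space. -/
theorem exists_matrix_range {a : ℕ} (K : Submodule R (Fin a → R)) :
    ∃ (c : ℕ) (B : Matrix (Fin a) (Fin c) R), ∀ x, x ∈ K ↔ ∃ y, B *ᵥ y = x := by
  obtain ⟨c, s, hs⟩ := Submodule.fg_iff_exists_fin_generating_family.1
    (IsNoetherian.noetherian K)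
  refine ⟨c, fun i j => s j i, fun x => ?_⟩
  rw [← hs, Submodule.mem_span_range_iff_exists_fun]
  refine exists_congr fun y => ?_
  have : (Matrix.mulVec (fun i j => s j i) y) = ∑ i, y i • s i := by
    ext i
    simp [Matrix.mulVec, dotProduct, mul_comm]
  rw [this]

/-- A matrix whose column space is the kernel of the given one. -/
noncomputable def syzygyMatrix {a b : ℕ} (A : Matrix (Fin a) (Fin b) R) :
    Σ c : ℕ, Matrix (Fin b) (Fin c) R :=
  ⟨_, (exists_matrix_range A.mulVecLin.ker).choose_spec.choose⟩

theorem syzygyMatrix_spec {a b : ℕ} (A : Matrix (Fin a) (Fin b) R) (x : Fin b → R) :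
    A *ᵥ x = 0 ↔ ∃ y, (syzygyMatrix A).2 *ᵥ y = x :=
  (exists_matrix_range A.mulVecLin.ker).choose_spec.choose_spec x

/-- The iterated syzygy matrices of a given matrix. -/
noncomputable def syzygySeq {a b : ℕ} (A : Matrix (Fin a) (Fin b) R) :
    ℕ → Σ a b : ℕ, Matrix (Fin a) (Fin b) R
  | 0 => ⟨a, b, A⟩
  | k + 1 => ⟨(syzygySeq A k).2.1, syzygyMatrix (syzygySeq A k).2.2⟩

/-- Over a noetherian ring, `R ⧸ J` has a resolution by finite free modules. -/
theorem exists_isResolution (J : Ideal R) : ∃ P : MatrixComplex R, P.IsResolution J := by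
  obtain ⟨b, A, hA⟩ := exists_matrix_range
    (Submodule.comap (LinearMap.proj (R := R) (φ := fun _ : Fin 1 => R) 0) J)
  let n : ℕ → ℕ := fun k => (syzygySeq A k).2.1
  let D : ∀ k, Matrix (Fin (complexRank n k)) (Fin (complexRank n (k + 1))) R
    | 0 => (syzygySeq A 0).2.2
    | k + 1 => (syzygySeq A (k + 1)).2.2
  have key : ∀ k x, D k *ᵥ x = 0 ↔ ∃ y, D (k + 1) *ᵥ y = x := by
    intro k x
    cases k with
    | zero => exact syzygyMatrix_spec _ _
    | succ k => exact syzygyMatrix_spec _ _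
  refine ⟨⟨n, D, fun k => ?_⟩, fun x => hA x, fun k x h => (key k x).1 h⟩
  ext i j
  exact congrFun ((key k (fun i => D (k + 1) i j)).2
    ⟨Pi.single j 1, by ext i; simp⟩) i

end Existence

end MatrixComplex

/-! ### From matrices to projective resolutions -/

namespace MatrixComplex

variable {R : Type u} [CommRing R]

/-- The chain complex of modules defined by a complex of matrices. -/
noncomputable def toChainComplex (P : MatrixComplex R) : ChainComplex (ModuleCat.{u} R) ℕ :=
  ChainComplex.of (fun k => ModuleCat.of R (Fin (P.rk k) → R))
    (fun k => ModuleCat.ofHom (P.D k).mulVecLin) (fun k => by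
      ext x : 2
      simp [← Matrix.mulVecLin_mul, P.D_mul_D])

theorem toChainComplex_d (P : MatrixComplex R) (k : ℕ) :
    P.toChainComplex.d (k + 1) k = ModuleCat.ofHom (P.D k).mulVecLin :=
  ChainComplex.of_d (fun k => ModuleCat.of R (Fin (P.rk k) → R))
    (fun k => ModuleCat.ofHom (P.D k).mulVecLin) k

theorem toChainComplex_d_apply (P : MatrixComplex R) (k : ℕ) (x : Fin (P.rk (k + 1)) → R) :
    (P.toChainComplex.d (k + 1) k).hom x = P.D k *ᵥ x := by
  rw [toChainComplex_d]
  rfl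

/-- The morphism of chain complexes defined by a chain map given by matrices. -/
noncomputable def Hom.toChainMap {Q P : MatrixComplex R} (g : Q.Hom P) :
    Q.toChainComplex ⟶ P.toChainComplex :=
  ChainComplex.ofHom (fun k => ModuleCat.ofHom (g.f k).mulVecLin) (fun k => by
    rw [toChainComplex_d, toChainComplex_d]
    change ModuleCat.ofHom _ ≫ ModuleCat.ofHom _ = ModuleCat.ofHom _ ≫ ModuleCat.ofHom _
    rw [← ModuleCat.ofHom_comp, ← ModuleCat.ofHom_comp, ← Matrix.mulVecLin_mul,
        ← Matrix.mulVecLin_mul, g.comm])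

/-- The augmentation `R = R¹ → R ⧸ J`. -/
noncomputable def augmentation (J : Ideal R) :
    ModuleCat.of R (Fin 1 → R) ⟶ ModuleCat.of R (R ⧸ J) :=
  ModuleCat.ofHom (J.mkQ ∘ₗ LinearMap.proj 0)

theorem augmentation_apply (J : Ideal R) (x : Fin 1 → R) :
    augmentation J x = Ideal.Quotient.mk J (x 0) := rfl

theorem IsResolution.d_comp_augmentation {P : MatrixComplex R} {J : Ideal R}
    (h : P.IsResolution J) :
    P.toChainComplex.d 1 0 ≫ augmentation J = 0 := by
  rw [toChainComplex_d]
  ext x : 2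
  change augmentation J (P.D 0 *ᵥ x) = 0
  rw [augmentation_apply]
  exact Ideal.Quotient.eq_zero_iff_mem.2 ((h.exact_zero _).2 ⟨x, rfl⟩)

/-- The projective resolution of `R ⧸ J` defined by a resolution given by matrices. -/
noncomputable def IsResolution.projectiveResolution {P : MatrixComplex R} {J : Ideal R}
    (h : P.IsResolution J) : ProjectiveResolution (ModuleCat.of R (R ⧸ J)) where
  complex := P.toChainComplex
  projective k := by
    change Projective (ModuleCat.of R (Fin (P.rk k) → R))
    exact ModuleCat.projective_of_free (Pi.basisFun R (Fin (P.rk k)))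
  π := (ChainComplex.toSingle₀Equiv _ _).symm ⟨augmentation J, h.d_comp_augmentation⟩
  quasiIso := ⟨fun n => by
    cases n
    · have hf := ChainComplex.toSingle₀Equiv_symm_apply_f_zero (C := P.toChainComplex)
        (augmentation J) h.d_comp_augmentation
      rw [ChainComplex.quasiIsoAt₀_iff, ShortComplex.quasiIso_iff_of_zeros']
      · refine (ShortComplex.exact_and_epi_g_iff_of_iso (S₂ := ShortComplex.mk
            (P.toChainComplex.d 1 0) (augmentation J) h.d_comp_augmentation) ?_).2 ⟨?_, ?_⟩
        · exact ShortComplex.isoMk (Iso.refl _) (Iso.refl _) (Iso.refl _)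
            ((Category.id_comp (P.toChainComplex.d 1 0)).trans
              (Category.comp_id (P.toChainComplex.d 1 0)).symm)
            ((Category.id_comp (augmentation J)).trans (hf.symm.trans
              (Category.comp_id (((ChainComplex.toSingle₀Equiv P.toChainComplex _).symm
                ⟨augmentation J, h.d_comp_augmentation⟩).f 0)).symm))
        · rw [ShortComplex.moduleCat_exact_iff]
          intro x hx
          obtain ⟨y, hy⟩ := (h.exact_zero x).1 (Ideal.Quotient.eq_zero_iff_mem.1 hx)
          refine ⟨y, ?_⟩
          exact (P.toChainComplex_d_apply 0 y).trans hy
        · rw [ModuleCat.epi_iff_surjective]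
          intro y
          obtain ⟨r, rfl⟩ := Ideal.Quotient.mk_surjective y
          exact ⟨fun _ => r, rfl⟩
      all_goals rfl
    · rename_i n
      rw [quasiIsoAt_iff_exactAt']
      · rw [HomologicalComplex.exactAt_iff' _ (n + 1 + 1) (n + 1) n (by simp) (by simp)]
        rw [ShortComplex.moduleCat_exact_iff]
        intro x hx
        obtain ⟨y, hy⟩ := h.exact_succ n x ((P.toChainComplex_d_apply n x).symm.trans hx)
        exact ⟨y, (P.toChainComplex_d_apply (n + 1) y).trans hy⟩
      · apply ChainComplex.exactAt_succ_single_obj⟩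

end MatrixComplex

namespace CategoryTheory.ProjectiveResolution

variable {R : Type u} [CommRing R] {X Y : ModuleCat.{u} R}

/-- The map on complexes of homomorphisms induced by a morphism of coefficients. -/
noncomputable def yonedaMap (K : ChainComplex (ModuleCat.{u} R) ℕ) {M N : ModuleCat.{u} R}
    (f : M ⟶ N) :
    K.linearYonedaObj R M ⟶ K.linearYonedaObj R N :=
  (HomologicalComplex.unopFunctor _ _).map
    (((NatTrans.mapHomologicalComplex ((linearYoneda R _).map f).rightOp _).app K).op)

/-- The map on complexes of homomorphisms induced by a chain map. -/
noncomputable def yonedaComap {K L : ChainComplex (ModuleCat.{u} R) ℕ} (φ : K ⟶ L)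
    (M : ModuleCat.{u} R) :
    L.linearYonedaObj R M ⟶ K.linearYonedaObj R M :=
  (HomologicalComplex.unopFunctor _ _).map
    (((((linearYoneda R (ModuleCat.{u} R)).obj M).rightOp.mapHomologicalComplex _).map φ).op)

theorem comp_inv_eq_inv_comp {V : Type*} [Category* V] {A A' B B' : V} (i : A ≅ A') (j : B ≅ B')
    {a : A ⟶ B} {b : A' ⟶ B'} (h : a ≫ j.hom = i.hom ≫ b) : b ≫ j.inv = i.inv ≫ a := by
  rw [Iso.comp_inv_eq, Category.assoc, h, Iso.inv_hom_id_assoc]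

/-- Composition of two naturality squares, the first of which lives in the opposite category. Stated
abstractly so that it applies to `Ext`, which is defined as the opposite of a left derived functor,
up to definitional equality. -/
theorem unop_comp_eq_of_comp_eq {V : Type*} [Category* V] {E E' H H' : Vᵒᵖ} {U U' : V}
    {t : E' ⟶ E} {i : H ⟶ E} {i' : H' ⟶ E'} {h : H' ⟶ H} {α : Opposite.unop H ⟶ U}
    {α' : Opposite.unop H' ⟶ U'} {w : U ⟶ U'} (h₁ : i' ≫ t = h ≫ i) (h₂ : h.unop ≫ α' = α ≫ w) :
    t.unop ≫ i'.unop ≫ α' = (i.unop ≫ α) ≫ w := by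
  rw [← Category.assoc, ← unop_comp, h₁, unop_comp, Category.assoc, Category.assoc, h₂]

/-- Naturality of the comparison of the homology of a complex with that of its opposite. -/
theorem homologyUnop_inv_naturality {V : Type*} [Category* V] [Limits.HasZeroMorphisms V]
    {ι : Type*} {c : ComplexShape ι} {K L : HomologicalComplex Vᵒᵖ c} (φ : K ⟶ L) (i : ι)
    [K.HasHomology i] [L.HasHomology i] :
    (HomologicalComplex.homologyMap φ i).unop ≫ (K.homologyUnop i).inv =
      (L.homologyUnop i).inv ≫
        HomologicalComplex.homologyMap ((HomologicalComplex.unopFunctor _ _).map φ.op) i :=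
  comp_inv_eq_inv_comp (L.homologyUnop i) (K.homologyUnop i)
    (congrArg Quiver.Hom.unop (HomologicalComplex.homologyOp_hom_naturality
      ((HomologicalComplex.unopFunctor _ _).map φ.op) i)).symm

/-- The computation of `Ext` by a projective resolution is natural in the second variable. -/
theorem isoExt_naturality_right (P : ProjectiveResolution X) (n : ℕ) {M N : ModuleCat.{u} R}
    (f : M ⟶ N) :
    ((Ext R (ModuleCat.{u} R) n).obj (Opposite.op X)).map f ≫ (P.isoExt n N).hom =
      (P.isoExt n M).hom ≫ HomologicalComplex.homologyMap (yonedaMap P.complex f) n := by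
  refine unop_comp_eq_of_comp_eq
    (t := (NatTrans.leftDerived ((linearYoneda R (ModuleCat.{u} R)).map f).rightOp n).app X)
    (h := HomologicalComplex.homologyMap ((NatTrans.mapHomologicalComplex
      ((linearYoneda R (ModuleCat.{u} R)).map f).rightOp _).app P.complex) n) ?_
    (homologyUnop_inv_naturality ((NatTrans.mapHomologicalComplex
      ((linearYoneda R (ModuleCat.{u} R)).map f).rightOp _).app P.complex) n)
  rw [leftDerived_app_eq _ P n]
  exact Iso.inv_hom_id_assoc
    (P.isoLeftDerivedObj ((linearYoneda R (ModuleCat.{u} R)).obj N).rightOp n) _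

/-- The computation of `Ext` by projective resolutions is natural in the first variable. -/
theorem isoExt_naturality_left (P : ProjectiveResolution X) (Q : ProjectiveResolution Y) (n : ℕ)
    (f : X ⟶ Y) (φ : P.complex ⟶ Q.complex) (comm : φ.f 0 ≫ Q.π.f 0 = P.π.f 0 ≫ f)
    (M : ModuleCat.{u} R) :
    ((Ext R (ModuleCat.{u} R) n).map f.op).app M ≫ (P.isoExt n M).hom =
      (Q.isoExt n M).hom ≫ HomologicalComplex.homologyMap (yonedaComap φ M) n :=
  unop_comp_eq_of_comp_eq
    (isoLeftDerivedObj_inv_naturality f P Q φ comm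
      ((linearYoneda R (ModuleCat.{u} R)).obj M).rightOp n)
    (homologyUnop_inv_naturality (((((linearYoneda R (ModuleCat.{u} R)).obj
      M).rightOp.mapHomologicalComplex _).map φ)) n)

end CategoryTheory.ProjectiveResolution

/-! ### Classes of cocycles -/

namespace CategoryTheory.ShortComplex

variable {R : Type u} [CommRing R] (S : ShortComplex (ModuleCat.{u} R))

/-- The class in the homology of a short complex of modules of an element of the kernel. -/
noncomputable def kerClass : LinearMap.ker S.g.hom →ₗ[R] S.homology :=
  (S.moduleCatCyclesIso.inv ≫ S.homologyπ).hom

theorem kerClass_surjective : Function.Surjective S.kerClass :=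
  (ModuleCat.epi_iff_surjective (S.moduleCatCyclesIso.inv ≫ S.homologyπ)).1 inferInstance

theorem kerClass_eq_zero_iff (x : LinearMap.ker S.g.hom) :
    S.kerClass x = 0 ↔ ∃ y, S.f.hom y = x := by
  have h1 : S.moduleCatHomologyIso.hom (S.kerClass x) = S.moduleCatLeftHomologyData.π x := by
    have : (S.moduleCatCyclesIso.inv ≫ S.homologyπ) ≫ S.moduleCatHomologyIso.hom =
        S.moduleCatLeftHomologyData.π := by
      rw [Category.assoc, π_moduleCatCyclesIso_hom, Iso.inv_hom_id_assoc]
    exact congrArg (fun f => f.hom x) this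
  have h2 : S.kerClass x = 0 ↔ S.moduleCatHomologyIso.hom (S.kerClass x) = 0 := by
    constructor
    · intro h
      rw [h, map_zero]
    · intro h
      have := congrArg S.moduleCatHomologyIso.inv h
      rwa [map_zero, Iso.hom_inv_id_apply] at this
  rw [h2, h1]
  have h3 : S.moduleCatLeftHomologyData.π x = 0 ↔ x ∈ LinearMap.range S.moduleCatToCycles :=
    Submodule.Quotient.mk_eq_zero _
  rw [h3]
  exact ⟨fun ⟨y, hy⟩ => ⟨y, congrArg Subtype.val hy⟩, fun ⟨y, hy⟩ => ⟨y, Subtype.ext hy⟩⟩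

theorem homologyMap_kerClass {S' : ShortComplex (ModuleCat.{u} R)} (φ : S ⟶ S')
    (x : LinearMap.ker S.g.hom) (x' : LinearMap.ker S'.g.hom) (h : φ.τ₂.hom x = x') :
    homologyMap φ (S.kerClass x) = S'.kerClass x' := by
  have h1 : S.moduleCatCyclesIso.inv ≫ S.homologyπ ≫ homologyMap φ =
      (S.moduleCatCyclesIso.inv ≫ cyclesMap φ ≫ S'.moduleCatCyclesIso.hom) ≫
        S'.moduleCatCyclesIso.inv ≫ S'.homologyπ := by
    rw [homologyπ_naturality, Category.assoc, Category.assoc, Iso.hom_inv_id_assoc]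
  have h2 : (S.moduleCatCyclesIso.inv ≫ cyclesMap φ ≫ S'.moduleCatCyclesIso.hom).hom x = x' := by
    apply Subtype.ext
    have h3 : (S.moduleCatCyclesIso.inv ≫ cyclesMap φ ≫ S'.moduleCatCyclesIso.hom) ≫
        S'.moduleCatLeftHomologyData.i = S.moduleCatLeftHomologyData.i ≫ φ.τ₂ := by
      simp
    exact (congrArg (fun f => f.hom x) h3).trans h
  refine (congrArg (fun f => f.hom x) h1).trans ?_
  change S'.kerClass ((S.moduleCatCyclesIso.inv ≫ cyclesMap φ ≫ S'.moduleCatCyclesIso.hom).hom x) = _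
  rw [h2]

end CategoryTheory.ShortComplex

namespace MatrixComplex

variable {R : Type u} [CommRing R]

/-- The cocycles in degree `i` of the complex of homomorphisms from `P` to a module. -/
def cocycles (P : MatrixComplex R) (i : ℕ) (M : Type u) [AddCommGroup M] [Module R M] :
    Submodule R (Fin (P.rk i) → M) :=
  LinearMap.ker ((P.D i)ᵀ.act M)

/-- The coboundaries in degree `i` of the complex of homomorphisms from `P` to a module. -/
def coboundaries (P : MatrixComplex R) (M : Type u) [AddCommGroup M] [Module R M] :
    (i : ℕ) → Submodule R (Fin (P.rk i) → M)
  | 0 => ⊥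
  | i + 1 => LinearMap.range ((P.D i)ᵀ.act M)

theorem mem_cocycles {P : MatrixComplex R} {i : ℕ} {M : Type u} [AddCommGroup M] [Module R M]
    {z : Fin (P.rk i) → M} : z ∈ P.cocycles i M ↔ (P.D i)ᵀ.act M z = 0 := Iff.rfl

theorem Hom.act_mem_cocycles {Q P : MatrixComplex R} (g : Q.Hom P) {i : ℕ} {M : Type u}
    [AddCommGroup M] [Module R M] {z : Fin (P.rk i) → M} (hz : z ∈ P.cocycles i M) :
    (g.f i)ᵀ.act M z ∈ Q.cocycles i M := by
  rw [mem_cocycles] at hz ⊢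
  rw [← Matrix.act_transpose_mul, g.comm, Matrix.act_transpose_mul, hz, map_zero]

theorem comp_mem_cocycles {P : MatrixComplex R} {i : ℕ} {M N : Type u}
    [AddCommGroup M] [Module R M] [AddCommGroup N] [Module R N] (f : M →ₗ[R] N)
    {z : Fin (P.rk i) → M} (hz : z ∈ P.cocycles i M) :
    (fun j => f (z j)) ∈ P.cocycles i N := by
  rw [mem_cocycles] at hz ⊢
  rw [Matrix.act_comp, hz]
  ext
  simp

/-- Homomorphisms out of a finite free module are tuples. -/
noncomputable def tupleHom (M : ModuleCat.{u} R) (n : ℕ) :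
    (Fin n → M) ≃ₗ[R] (ModuleCat.of R (Fin n → R) ⟶ M) :=
  (Module.Basis.constr (Pi.basisFun R (Fin n)) R).trans
    (ModuleCat.homLinearEquiv (S := R) (M := ModuleCat.of R (Fin n → R)) (N := M)).symm

theorem tupleHom_apply (M : ModuleCat.{u} R) (n : ℕ) (z : Fin n → M) (x : Fin n → R) :
    (tupleHom M n z).hom x = ∑ i, x i • z i := by
  change (Pi.basisFun R (Fin n)).constr R z x = _
  simp [Module.Basis.constr_apply_fintype]

theorem comp_tupleHom (M : ModuleCat.{u} R) {m n : ℕ} (A : Matrix (Fin m) (Fin n) R)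
    (z : Fin m → M) :
    ModuleCat.ofHom A.mulVecLin ≫ tupleHom M m z = tupleHom M n (Aᵀ.act M z) := by
  refine ModuleCat.hom_ext (LinearMap.ext fun x => ?_)
  change (tupleHom M m z).hom (A *ᵥ x) = _
  rw [tupleHom_apply, tupleHom_apply]
  simp only [Matrix.mulVec, dotProduct, Finset.sum_smul, Matrix.act_apply, Finset.smul_sum,
    Matrix.transpose_apply, smul_smul]
  rw [Finset.sum_comm]
  simp only [mul_comm]

theorem tupleHom_comp {M N : ModuleCat.{u} R} (f : M ⟶ N) (n : ℕ) (z : Fin n → M) :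
    tupleHom M n z ≫ f = tupleHom N n (fun i => f.hom (z i)) := by
  refine ModuleCat.hom_ext (LinearMap.ext fun x => ?_)
  change f.hom ((tupleHom M n z).hom x) = _
  rw [tupleHom_apply, tupleHom_apply]
  simp

theorem d_comp_tupleHom (P : MatrixComplex R) (i : ℕ) (M : ModuleCat.{u} R)
    (z : Fin (P.rk i) → M) :
    P.toChainComplex.d (i + 1) i ≫ tupleHom M _ z = tupleHom M _ ((P.D i)ᵀ.act M z) := by
  rw [toChainComplex_d]
  exact comp_tupleHom M (P.D i) z

/-- The short complex computing the cohomology of the complex of homomorphisms from `P` to `M`. -/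
noncomputable abbrev homSc (P : MatrixComplex R) (i : ℕ) (M : ModuleCat.{u} R) :
    ShortComplex (ModuleCat.{u} R) :=
  (P.toChainComplex.linearYonedaObj R M).sc i

theorem homSc_g_eq_zero_iff (P : MatrixComplex R) (i : ℕ) (M : ModuleCat.{u} R)
    (z : Fin (P.rk i) → M) :
    (P.homSc i M).g.hom (tupleHom M _ z) = 0 ↔ z ∈ P.cocycles i M := by
  have h : ∀ j, j = i + 1 → (((P.toChainComplex.linearYonedaObj R M).d i j).hom
      (tupleHom M _ z) = 0 ↔ z ∈ P.cocycles i M) := by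
    rintro j rfl
    have : ((P.toChainComplex.linearYonedaObj R M).d i (i + 1)).hom (tupleHom M _ z) =
        P.toChainComplex.d (i + 1) i ≫ tupleHom M _ z := rfl
    rw [this, d_comp_tupleHom]
    exact LinearEquiv.map_eq_zero_iff _
  exact h _ (by simp)

theorem exists_homSc_f_eq_iff (P : MatrixComplex R) (i : ℕ) (M : ModuleCat.{u} R)
    (z : Fin (P.rk i) → M) :
    (∃ y, (P.homSc i M).f.hom y = tupleHom M _ z) ↔ z ∈ P.coboundaries M i := by
  cases i with
  | zero =>
    have : (P.homSc 0 M).f = 0 :=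
      (P.toChainComplex.linearYonedaObj R M).shape _ _ (fun h => Nat.succ_ne_zero _ h)
    rw [this]
    constructor
    · rintro ⟨y, hy⟩
      exact (LinearEquiv.map_eq_zero_iff (tupleHom M _)).1 hy.symm
    · intro hz
      exact ⟨0, ((LinearEquiv.map_eq_zero_iff (tupleHom M _)).2 hz).symm⟩
  | succ i =>
    have h : ∀ j, j = i → ((∃ y, ((P.toChainComplex.linearYonedaObj R M).d j (i + 1)).hom y =
      (tupleHom M _ z)) ↔ z ∈ P.coboundaries M (i + 1)) := by
      rintro j rfl
      constructor
      · rintro ⟨y, hy⟩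
        obtain ⟨y, rfl⟩ := (tupleHom M _).surjective y
        refine ⟨y, (tupleHom M _).injective ?_⟩
        rw [← d_comp_tupleHom, ← hy]
        rfl
      · rintro ⟨y, rfl⟩
        refine ⟨tupleHom M _ y, ?_⟩
        rw [← d_comp_tupleHom]
        rfl
    exact h _ (by simp)

end MatrixComplex

namespace MatrixComplex

variable {R : Type u} [CommRing R] {P Q : MatrixComplex R} {J J' : Ideal R}

/-- A cocycle as an element of the kernel in the short complex computing cohomology. -/
noncomputable def cocycleToKer (P : MatrixComplex R) (i : ℕ) (M : ModuleCat.{u} R) :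
    P.cocycles i M →ₗ[R] LinearMap.ker (P.homSc i M).g.hom :=
  ((tupleHom M (P.rk i)).toLinearMap ∘ₗ (P.cocycles i M).subtype).codRestrict _
    (fun z => (P.homSc_g_eq_zero_iff i M z).2 z.2)

theorem coe_cocycleToKer (i : ℕ) (M : ModuleCat.{u} R) (z : P.cocycles i M) :
    (P.cocycleToKer i M z : (P.homSc i M).X₂) = tupleHom M (P.rk i) z := rfl

theorem cocycleToKer_surjective (i : ℕ) (M : ModuleCat.{u} R) :
    Function.Surjective (P.cocycleToKer i M) := by
  rintro ⟨y, hy⟩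
  obtain ⟨z, rfl⟩ := (tupleHom M (P.rk i)).surjective y
  exact ⟨⟨z, (P.homSc_g_eq_zero_iff i M z).1 hy⟩, rfl⟩

namespace IsResolution

/-- The class in `Ext` of a cocycle. -/
noncomputable def extClass (h : P.IsResolution J) (i : ℕ) (M : ModuleCat.{u} R) :
    P.cocycles i M →ₗ[R]
      ((Ext R (ModuleCat.{u} R) i).obj (Opposite.op (ModuleCat.of R (R ⧸ J)))).obj M :=
  (h.projectiveResolution.isoExt i M).inv.hom ∘ₗ (P.homSc i M).kerClass ∘ₗ P.cocycleToKer i M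

theorem isoExt_hom_extClass (h : P.IsResolution J) (i : ℕ) (M : ModuleCat.{u} R)
    (z : P.cocycles i M) : (h.projectiveResolution.isoExt i M).hom.hom (h.extClass i M z) =
      (P.homSc i M).kerClass (P.cocycleToKer i M z) :=
  Iso.inv_hom_id_apply (h.projectiveResolution.isoExt i M) _

theorem isoExt_hom_injective (h : P.IsResolution J) (i : ℕ) (M : ModuleCat.{u} R) :
    Function.Injective (h.projectiveResolution.isoExt (R := R) i M).hom.hom :=
  ((ModuleCat.mono_iff_injective (h.projectiveResolution.isoExt (R := R) i M).hom).1 inferInstance)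

theorem extClass_surjective (h : P.IsResolution J) (i : ℕ) (M : ModuleCat.{u} R) :
    Function.Surjective (h.extClass i M) := by
  intro x
  obtain ⟨y, hy⟩ := (P.homSc i M).kerClass_surjective
    ((h.projectiveResolution.isoExt i M).hom.hom x)
  obtain ⟨z, rfl⟩ := cocycleToKer_surjective i M y
  refine ⟨z, h.isoExt_hom_injective i M ?_⟩
  rw [isoExt_hom_extClass, hy]

theorem extClass_eq_zero_iff (h : P.IsResolution J) (i : ℕ) (M : ModuleCat.{u} R)
    (z : P.cocycles i M) :
    h.extClass i M z = 0 ↔ (z : Fin (P.rk i) → M) ∈ P.coboundaries M i := by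
  rw [← P.exists_homSc_f_eq_iff, ← coe_cocycleToKer, ← ShortComplex.kerClass_eq_zero_iff,
    ← h.isoExt_hom_extClass]
  exact ((map_eq_zero_iff _ (h.isoExt_hom_injective i M))).symm

theorem map_extClass (h : P.IsResolution J) (i : ℕ) {M N : ModuleCat.{u} R} (f : M ⟶ N)
    (z : P.cocycles i M) :
    (((Ext R (ModuleCat.{u} R) i).obj _).map f).hom (h.extClass i M z) =
      h.extClass i N ⟨fun j => f.hom (z.1 j), comp_mem_cocycles f.hom z.2⟩ := by
  apply h.isoExt_hom_injective i N
  rw [isoExt_hom_extClass]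
  refine (congrArg (fun g => g.hom (h.extClass i M z))
    (h.projectiveResolution.isoExt_naturality_right i f)).trans ?_
  refine (congrArg (HomologicalComplex.homologyMap (ProjectiveResolution.yonedaMap
    h.projectiveResolution.complex f) i).hom (h.isoExt_hom_extClass i M z)).trans ?_
  exact ShortComplex.homologyMap_kerClass _ _ _ _ (tupleHom_comp f _ _)

theorem map_extClass_of_hom (h : P.IsResolution J) (h' : Q.IsResolution J') (g : Q.Hom P) (i : ℕ)
    (f : ModuleCat.of R (R ⧸ J') ⟶ ModuleCat.of R (R ⧸ J))
    (hf : ∀ r, f.hom (Ideal.Quotient.mk J' r) = Ideal.Quotient.mk J r) (M : ModuleCat.{u} R)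
    (z : P.cocycles i M) :
    (((Ext R (ModuleCat.{u} R) i).map f.op).app M).hom (h.extClass i M z) =
      h'.extClass i M ⟨(g.f i)ᵀ.act M z.1, g.act_mem_cocycles z.2⟩ := by
  apply h'.isoExt_hom_injective i M
  rw [isoExt_hom_extClass]
  have comm : g.toChainMap.f 0 ≫ h.projectiveResolution.π.f 0 =
      h'.projectiveResolution.π.f 0 ≫ f := by
    have h1 : h.projectiveResolution.π.f 0 = augmentation J :=
      ChainComplex.toSingle₀Equiv_symm_apply_f_zero _ _
    have h2 : h'.projectiveResolution.π.f 0 = augmentation J' :=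
      ChainComplex.toSingle₀Equiv_symm_apply_f_zero _ _
    rw [h1, h2]
    refine ModuleCat.hom_ext (LinearMap.ext fun x => ?_)
    change augmentation J (g.f 0 *ᵥ x) = f.hom (augmentation J' x)
    rw [g.zero]
    have : (1 : Matrix (Fin 1) (Fin 1) R) *ᵥ x = x := Matrix.one_mulVec _
    erw [this, augmentation_apply, augmentation_apply, hf]
    rfl
  refine (congrArg (fun g => g.hom (h.extClass i M z))
    (h'.projectiveResolution.isoExt_naturality_left h.projectiveResolution i f g.toChainMap
      comm M)).trans ?_
  refine (congrArg (HomologicalComplex.homologyMap (ProjectiveResolution.yonedaComap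
    g.toChainMap M) i).hom (h.isoExt_hom_extClass i M z)).trans ?_
  exact ShortComplex.homologyMap_kerClass _ _ _ _ (comp_tupleHom M (g.f i) _)

end IsResolution

/-! ### Local cohomology classes of cocycles -/

section LocalCohomology

variable {I : Ideal R} {P : ℕ → MatrixComplex R}

open localCohomology Opposite Limits

/-- The structure map from `Ext` to local cohomology. -/
noncomputable def extToLocalCohomology (I : Ideal R) (t i : ℕ) (M : ModuleCat.{u} R) :
    ((Ext R (ModuleCat.{u} R) i).obj (Opposite.op (ModuleCat.of R (R ⧸ I ^ t)))).obj M →ₗ[R]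
      (localCohomology I i).obj M :=
  ((colimit.ι (diagram (idealPowersDiagram I) i) (op (op t))).app M).hom

/-- The class in local cohomology of a cocycle on a resolution of `R ⧸ I ^ t`. -/
noncomputable def lcClass (h : ∀ t, (P t).IsResolution (I ^ t)) (t i : ℕ) (M : ModuleCat.{u} R) :
    (P t).cocycles i M →ₗ[R] (localCohomology I i).obj M :=
  extToLocalCohomology I t i M ∘ₗ (h t).extClass i M

theorem lcClass_apply (h : ∀ t, (P t).IsResolution (I ^ t)) (t i : ℕ) (M : ModuleCat.{u} R)
    (z : (P t).cocycles i M) :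
    lcClass h t i M z = extToLocalCohomology I t i M ((h t).extClass i M z) := rfl

theorem map_lcClass (h : ∀ t, (P t).IsResolution (I ^ t)) (t i : ℕ) {M N : ModuleCat.{u} R}
    (f : M ⟶ N) (z : (P t).cocycles i M) :
    ((localCohomology I i).map f).hom (lcClass h t i M z) =
      lcClass h t i N ⟨fun j => f.hom (z.1 j), comp_mem_cocycles f.hom z.2⟩ := by
  refine (congrArg (fun g => g.hom ((h t).extClass i M z))
    ((colimit.ι (diagram (idealPowersDiagram I) i) (op (op t))).naturality f).symm).trans ?_
  exact congrArg ((colimit.ι (diagram (idealPowersDiagram I) i) (op (op t))).app N).hom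
    ((h t).map_extClass i f z)

theorem diagram_map_extClass (h : ∀ t, (P t).IsResolution (I ^ t)) {s t : ℕ} (i : ℕ)
    (w : (op (op t) : ℕᵒᵖᵒᵖ) ⟶ op (op s)) (g : (P s).Hom (P t)) (M : ModuleCat.{u} R)
    (z : (P t).cocycles i M) :
    (((diagram (idealPowersDiagram I) i).map w).app M).hom ((h t).extClass i M z) =
      (h s).extClass i M ⟨(g.f i)ᵀ.act M z.1, g.act_mem_cocycles z.2⟩ :=
  (h t).map_extClass_of_hom (h s) g i _ (fun _ => rfl) M z

theorem lcClass_comp (h : ∀ t, (P t).IsResolution (I ^ t)) {s t : ℕ} (hst : t ≤ s) (i : ℕ)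
    (g : (P s).Hom (P t)) (M : ModuleCat.{u} R) (z : (P t).cocycles i M) :
    lcClass h s i M ⟨(g.f i)ᵀ.act M z.1, g.act_mem_cocycles z.2⟩ = lcClass h t i M z := by
  have hw := colimit.w (diagram (idealPowersDiagram I) i) (homOfLE hst).op.op
  rw [lcClass_apply, lcClass_apply, ← diagram_map_extClass h i (homOfLE hst).op.op g]
  exact congrArg (fun g => (g.app M).hom ((h t).extClass i M z)) hw

instance forgetPreservesFilteredColimitsOfSize :
    PreservesFilteredColimitsOfSize.{0, 0} (forget (ModuleCat.{u} R)) :=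
  preservesFilteredColimitsOfSize_of_univLE.{u, u} _

/-- Evaluating the colimit defining local cohomology at a module gives a colimit. -/
noncomputable def isColimitEval (I : Ideal R) (i : ℕ) (M : ModuleCat.{u} R) :
    IsColimit (((evaluation _ _).obj M).mapCocone
      (colimit.cocone (diagram (idealPowersDiagram I) i))) :=
  isColimitOfPreserves ((evaluation _ _).obj M)
    (colimit.isColimit (diagram (idealPowersDiagram I) i))

theorem exists_lcClass_eq (h : ∀ t, (P t).IsResolution (I ^ t)) (i : ℕ) (M : ModuleCat.{u} R)
    (x : (localCohomology I i).obj M) : ∃ t z, lcClass h t i M z = x := by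
  obtain ⟨⟨⟨t⟩⟩, y, hy⟩ := Concrete.isColimit_exists_rep _ (isColimitEval I i M) x
  obtain ⟨z, rfl⟩ := (h t).extClass_surjective i M y
  exact ⟨t, z, hy⟩

theorem lcClass_eq_zero_of_mem (h : ∀ t, (P t).IsResolution (I ^ t)) {t i : ℕ}
    {M : ModuleCat.{u} R} (z : (P t).cocycles i M)
    (hz : (z : Fin ((P t).rk i) → M) ∈ (P t).coboundaries M i) : lcClass h t i M z = 0 := by
  rw [lcClass_apply, ((h t).extClass_eq_zero_iff i M z).2 hz, map_zero]

theorem exists_mem_coboundaries (h : ∀ t, (P t).IsResolution (I ^ t)) {t i : ℕ}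
    {M : ModuleCat.{u} R} (z : (P t).cocycles i M) (hz : lcClass h t i M z = 0) :
    ∃ s, t ≤ s ∧ ∀ g : (P s).Hom (P t), (g.f i)ᵀ.act M z.1 ∈ (P s).coboundaries M i := by
  have h0 : lcClass h t i M z = lcClass h t i M 0 := by rw [hz, map_zero]
  obtain ⟨⟨⟨s⟩⟩, f, f', hs⟩ := Concrete.isColimit_exists_of_rep_eq _ (isColimitEval I i M) _ _ h0
  refine ⟨s, leOfHom f.unop.unop, fun g => ?_⟩
  rw [← (h s).extClass_eq_zero_iff i M ⟨_, g.act_mem_cocycles z.2⟩,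
    ← diagram_map_extClass h i f g]
  refine hs.trans ?_
  rw [map_zero]
  exact map_zero _

end LocalCohomology

end MatrixComplex

/-! ### Lifting chain maps and homotopies -/

namespace MatrixComplex

variable {R : Type u} [CommRing R] {P Q : MatrixComplex R} {J J' : Ideal R}

theorem IsResolution.D_zero_mem (h : P.IsResolution J) (i) (j) : P.D 0 i j ∈ J := by
  have : (fun i => P.D 0 i j) (0 : Fin 1) ∈ J :=
    (h.exact_zero (fun i => P.D 0 i j)).2 ⟨Pi.single j 1, by ext i; simp⟩
  rwa [← Subsingleton.elim (α := Fin 1) i 0] at this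

theorem IsResolution.exists_mul_eq (h : P.IsResolution J) {k : ℕ} {n : Type*} [Fintype n]
    (A : Matrix (Fin (P.rk (k + 1))) n R) (hA : P.D k * A = 0) :
    ∃ B : Matrix (Fin (P.rk (k + 2))) n R, P.D (k + 1) * B = A := by
  refine Matrix.exists_mul_eq_of_forall_col _ _ fun j => h.exact_succ _ _ ?_
  rw [Matrix.col_mul, hA]
  rfl

theorem IsResolution.exists_D_zero_mul_eq (h : P.IsResolution J) {n : Type*} [Fintype n]
    (A : Matrix (Fin 1) n R) (hA : ∀ j, A 0 j ∈ J) :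
    ∃ B : Matrix (Fin (P.rk 1)) n R, P.D 0 * B = A :=
  Matrix.exists_mul_eq_of_forall_col _ _ fun j => (h.exact_zero _).1 (hA j)

/-- The lift of the identity of `R` to a resolution, degree by degree. -/
noncomputable def IsResolution.liftAux (h : P.IsResolution J) (hQ : ∀ j, Q.D 0 (0 : Fin 1) j ∈ J) :
    ∀ k, {A : Matrix (Fin (P.rk k)) (Fin (Q.rk k)) R // ∃ B : Matrix (Fin (P.rk (k + 1)))
      (Fin (Q.rk (k + 1))) R, P.D k * B = A * Q.D k}
  | 0 => ⟨(1 : Matrix (Fin 1) (Fin 1) R), by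
      obtain ⟨B, hB⟩ := h.exists_D_zero_mul_eq (Q.D 0) hQ
      exact ⟨B, hB.trans (Matrix.one_mul _).symm⟩⟩
  | k + 1 => ⟨(liftAux h hQ k).2.choose, h.exists_mul_eq _ (by
      rw [← Matrix.mul_assoc, (liftAux h hQ k).2.choose_spec, Matrix.mul_assoc, Q.D_mul_D,
        Matrix.mul_zero])⟩

/-- A complex maps to a resolution of `R ⧸ J` as soon as the image of its first differential lies
in `J`. -/
noncomputable def IsResolution.lift (h : P.IsResolution J)
    (hQ : ∀ j, Q.D 0 (0 : Fin 1) j ∈ J) : Q.Hom P where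
  f k := h.liftAux hQ k
  comm k := by
    conv_rhs => rw [liftAux]
    exact (h.liftAux hQ k).2.choose_spec.symm
  zero := by rw [liftAux]

/-- A null-homotopic map sends cocycles to coboundaries. -/
theorem act_transpose_mem_coboundaries {M : Type u} [AddCommGroup M] [Module R M] {i : ℕ}
    {z : Fin (P.rk (i + 1)) → M} (hz : z ∈ P.cocycles (i + 1) M)
    {A : Matrix (Fin (P.rk (i + 1))) (Fin (Q.rk (i + 1))) R}
    {h : Matrix (Fin (P.rk (i + 1))) (Fin (Q.rk i)) R}
    {h' : Matrix (Fin (P.rk (i + 2))) (Fin (Q.rk (i + 1))) R}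
    (hA : A = P.D (i + 1) * h' + h * Q.D i) :
    Aᵀ.act M z ∈ Q.coboundaries M (i + 1) := by
  refine ⟨hᵀ.act M z, ?_⟩
  rw [mem_cocycles] at hz
  rw [hA, Matrix.transpose_add, Matrix.act_add, Matrix.act_transpose_mul, hz, map_zero, zero_add,
    Matrix.act_transpose_mul]

/-- A chain map to a resolution that vanishes in degree `0` is zero on cohomology classes. Only the
part of the chain map in degrees up to `i` matters for the classes of degree `i`. -/
theorem IsResolution.act_mem_coboundaries (h : P.IsResolution J) {i : ℕ}
    (f : ∀ k, Matrix (Fin (P.rk k)) (Fin (Q.rk k)) R) (h0 : f 0 = 0)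
    (hf : ∀ j < i, f j * Q.D j = P.D j * f (j + 1))
    {M : Type u} [AddCommGroup M] [Module R M] {z : Fin (P.rk i) → M} (hz : z ∈ P.cocycles i M) :
    (f i)ᵀ.act M z ∈ Q.coboundaries M i := by
  cases i with
  | zero =>
    rw [h0, Matrix.transpose_zero, Matrix.act_zero]
    exact zero_mem _
  | succ i =>
    have key : ∀ k ≤ i, ∃ (a : Matrix (Fin (P.rk (k + 1))) (Fin (Q.rk k)) R)
        (b : Matrix (Fin (P.rk (k + 2))) (Fin (Q.rk (k + 1))) R),
          f (k + 1) = P.D (k + 1) * b + a * Q.D k := by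
      intro k
      induction k with
      | zero =>
        intro hk
        obtain ⟨b, hb⟩ := h.exists_mul_eq (k := 0) (f 1) (by
          rw [← hf 0 (Nat.succ_pos _), h0, Matrix.zero_mul])
        exact ⟨0, b, by rw [hb, Matrix.zero_mul, add_zero]⟩
      | succ k ih =>
        intro hk
        obtain ⟨a, b, hab⟩ := ih (Nat.le_of_succ_le hk)
        obtain ⟨c, hc⟩ := h.exists_mul_eq (k := k + 1) (f (k + 2) - b * Q.D (k + 1)) (by
          rw [Matrix.mul_sub, ← hf (k + 1) (Nat.lt_succ_of_le hk), hab, Matrix.add_mul,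
            Matrix.mul_assoc a, Q.D_mul_D, Matrix.mul_zero, add_zero, Matrix.mul_assoc, sub_self])
        exact ⟨b, c, by rw [hc, sub_add_cancel]⟩
    obtain ⟨a, b, hab⟩ := key i le_rfl
    exact act_transpose_mem_coboundaries hz hab

/-- Two chain maps to a resolution induce the same map on cohomology classes. -/
theorem IsResolution.sub_mem_coboundaries (h : P.IsResolution J) (g g' : Q.Hom P)
    {M : Type u} [AddCommGroup M] [Module R M] (i : ℕ)
    {z : Fin (P.rk i) → M} (hz : z ∈ P.cocycles i M) :
    (g.f i)ᵀ.act M z - (g'.f i)ᵀ.act M z ∈ Q.coboundaries M i := by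
  rw [← Matrix.act_sub, ← Matrix.transpose_sub]
  refine h.act_mem_coboundaries (fun k => g.f k - g'.f k) ?_ (fun j _ => ?_) hz
  · exact sub_eq_zero.2 (g.zero.trans g'.zero.symm)
  · rw [Matrix.sub_mul, g.comm, g'.comm, Matrix.mul_sub]

/-! ### Vanishing of the inverse system of `Tor` modules -/

section ProZero

/-- `J • K` lies in the image of the first differential with coefficients in `K`. -/
theorem IsResolution.exists_act_eq_of_mem_smul {P : MatrixComplex R} (h : P.IsResolution J)
    {N : Type*} [AddCommGroup N] [Module R N]
    (K : Submodule R N) {v : N} (hv : v ∈ J • K) :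
    ∃ w : Fin (P.rk 1) → K, ∀ i, ((P.D 0).act K w i : N) = v := by
  induction hv using Submodule.smul_induction_on' with
  | smul r hr n hn =>
    obtain ⟨y, hy⟩ := (h.exact_zero (fun _ => r)).1 hr
    refine ⟨fun j => y j • ⟨n, hn⟩, fun i => ?_⟩
    have := congrFun hy i
    rw [Matrix.act_apply]
    simp only [smul_smul, ← Finset.sum_smul]
    exact congrArg (· • n) this
  | add x hx y hy ihx ihy =>
    obtain ⟨w, hw⟩ := ihx
    obtain ⟨w', hw'⟩ := ihy
    refine ⟨w + w', fun i => ?_⟩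
    rw [map_add, Pi.add_apply, Submodule.coe_add, hw, hw']

/-- Resolutions by finite free modules stay exact with finite free coefficients. -/
theorem IsResolution.exists_act_pi_eq {P : MatrixComplex R} (h : P.IsResolution J) {m : ℕ} (k : ℕ)
    (x : Fin (P.rk (k + 1)) → Fin m → R) (hx : (P.D k).act (Fin m → R) x = 0) :
    ∃ y, (P.D (k + 1)).act (Fin m → R) y = x := by
  have : ∀ l : Fin m, ∃ y, P.D (k + 1) *ᵥ y = fun j => x j l := by
    intro l
    refine h.exact_succ _ _ ?_
    rw [← Matrix.act_pi, hx]
    rfl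
  choose y hy using this
  refine ⟨fun j l => y l j, ?_⟩
  ext i l
  exact (congrFun (Matrix.act_pi (P.D (k + 1)) (fun j l => y l j) l) i).trans (congrFun (hy l) i)

variable {I : Ideal R} {P : ℕ → MatrixComplex R}

/-- The inductive step from syzygies to modules in the proof of `exists_act_D_eq`. -/
theorem exists_act_D_eq_of_syzygy (h : ∀ t, (P t).IsResolution (I ^ t)) (k : ℕ)
    (ih : ∀ (m : ℕ) (K : Submodule R (Fin m → R)) (s : ℕ), ∃ s₁, s ≤ s₁ ∧
      ∀ (g : (P s₁).Hom (P s)) (v : Fin ((P s₁).rk k) → K)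
        (x : Fin ((P s₁).rk (k + 1)) → Fin m → R),
        ((P s₁).D k).act _ x = (fun i => (v i : Fin m → R)) →
        ∃ w, ((P s).D k).act K w = (g.f k).act K v)
    (N : Type u) [AddCommGroup N] [Module R N] [Module.Finite R N] (s : ℕ) :
    ∃ s₁, s ≤ s₁ ∧ ∀ (g : (P s₁).Hom (P s)) (x : Fin ((P s₁).rk (k + 1)) → N),
      ((P s₁).D k).act N x = 0 → ∃ y, ((P s).D (k + 1)).act N y = (g.f (k + 1)).act N x := by
  obtain ⟨m, π, hπ⟩ := Module.Finite.exists_fin' R N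
  obtain ⟨s₁, hs, H⟩ := ih m (LinearMap.ker π) s
  refine ⟨s₁, hs, fun g x hx => ?_⟩
  choose x' hx' using fun j => hπ (x j)
  have hx'' : x = fun j => π (x' j) := funext fun j => (hx' j).symm
  have hv : ∀ i, ((P s₁).D k).act _ x' i ∈ LinearMap.ker π := by
    intro i
    have := congrFun (Matrix.act_comp ((P s₁).D k) π x') i
    rw [LinearMap.mem_ker, ← this, ← hx'', hx]
    rfl
  obtain ⟨w, hw⟩ := H g (fun i => ⟨_, hv i⟩) x' rfl
  obtain ⟨y, hy⟩ := (h s).exists_act_pi_eq k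
    ((g.f (k + 1)).act _ x' - fun j => (w j : Fin m → R)) (by
      rw [map_sub, ← Matrix.act_mul, ← g.comm, Matrix.act_mul, sub_eq_zero]
      have h1 := Matrix.act_comp ((P s).D k) (LinearMap.ker π).subtype w
      have h2 := Matrix.act_comp (g.f k) (LinearMap.ker π).subtype (fun i => ⟨_, hv i⟩)
      rw [hw] at h1
      exact h2.trans h1.symm)
  refine ⟨fun j => π (y j), ?_⟩
  rw [Matrix.act_comp, hy, hx'', Matrix.act_comp]
  ext i
  rw [Pi.sub_apply, map_sub, (LinearMap.mem_ker.1 (w i).2), sub_zero]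

/-- For a finite module `N`, the inverse system `Tor_{k+1}(R ⧸ I ^ s, N)` is essentially zero. The
case of `Tor₁` is the Artin-Rees lemma, and the general case follows by dimension shifting. -/
theorem exists_act_D_eq [IsNoetherianRing R] (h : ∀ t, (P t).IsResolution (I ^ t)) (k : ℕ)
    (N : Type u) [AddCommGroup N] [Module R N] [Module.Finite R N] (s : ℕ) :
    ∃ s₁, s ≤ s₁ ∧ ∀ (g : (P s₁).Hom (P s)) (x : Fin ((P s₁).rk (k + 1)) → N),
      ((P s₁).D k).act N x = 0 → ∃ y, ((P s).D (k + 1)).act N y = (g.f (k + 1)).act N x := by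
  induction k generalizing N s with
  | zero =>
    refine exists_act_D_eq_of_syzygy h 0 (fun m K s => ?_) N s
    obtain ⟨c, hc⟩ := I.exists_pow_inf_eq_pow_smul K
    refine ⟨s + c, Nat.le_add_right _ _, fun g v x hx => ?_⟩
    have h1 : ∀ i, (v i : Fin m → R) ∈ I ^ s • K := by
      intro i
      have h2 : (v i : Fin m → R) ∈ I ^ (s + c) • (⊤ : Submodule R (Fin m → R)) := by
        rw [← congrFun hx i, Matrix.act_apply]
        exact Submodule.sum_mem _ fun j _ =>
          Submodule.smul_mem_smul ((h (s + c)).D_zero_mem _ _) trivial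
      have h3 := (hc (s + c) (Nat.le_add_left _ _)).le ⟨h2, (v i).2⟩
      rw [Nat.add_sub_cancel] at h3
      exact Submodule.smul_mono le_rfl inf_le_right h3
    obtain ⟨w, hw⟩ := (h s).exists_act_eq_of_mem_smul K (h1 (0 : Fin 1))
    refine ⟨w, ?_⟩
    have h4 : (g.f 0).act K v = v := by
      rw [g.zero]
      exact Matrix.act_one v
    rw [h4]
    ext i : 2
    exact (hw i).trans (congrArg (fun i => (v i : Fin m → R)) (Subsingleton.elim (α := Fin 1) 0 i))
  | succ k ih =>
    refine exists_act_D_eq_of_syzygy h (k + 1) (fun m K s => ?_) N s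
    obtain ⟨s₁, hs, H⟩ := ih K s
    refine ⟨s₁, hs, fun g v x hx => H g v ?_⟩
    have h1 := Matrix.act_comp ((P s₁).D k) K.subtype v
    have h2 : (fun j => K.subtype (v j)) = ((P s₁).D (k + 1)).act _ x := hx.symm
    rw [h2, ← Matrix.act_mul, (P s₁).D_mul_D, Matrix.act_zero] at h1
    ext i : 2
    exact (congrFun h1 i).symm

end ProZero

end MatrixComplex

/-! ### Base change of resolutions along a finite endomorphism -/

namespace MatrixComplex

section Endomorphism

variable {R : Type u} [CommRing R] {I : Ideal R} {P : ℕ → MatrixComplex R} (σ : R →+* R)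

/-- The cohomology of `P` with coefficients in a restriction of scalars along `σ` is that of the
base change of `P` along `σ`. -/
theorem mem_coboundaries_restrictScalars {Q : MatrixComplex R} {M : ModuleCat.{u} R} {i : ℕ}
    {z : Fin (Q.rk i) → M} :
    z ∈ Q.coboundaries ((ModuleCat.restrictScalars σ).obj M) i ↔
      z ∈ (Q.map σ).coboundaries M i := by
  cases i <;> rfl

theorem mem_cocycles_restrictScalars {Q : MatrixComplex R} {M : ModuleCat.{u} R} {i : ℕ}
    {z : Fin (Q.rk i) → M} :
    z ∈ Q.cocycles i ((ModuleCat.restrictScalars σ).obj M) ↔ z ∈ (Q.map σ).cocycles i M := Iff.rfl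

variable (hP : ∀ t, (P t).IsResolution (I ^ t))

include hP in
theorem exists_hom {s t : ℕ} (hst : t ≤ s) : Nonempty ((P s).Hom (P t)) :=
  ⟨(hP t).lift fun j => Ideal.pow_le_pow_right hst ((hP s).D_zero_mem _ j)⟩

variable [IsNoetherianRing R]
  [Module.Finite R ((ModuleCat.restrictScalars σ).obj (ModuleCat.of R R))]

include hP in
/-- The inverse system of the base changes of the resolutions of `R ⧸ I ^ s` has essentially zero
homology in positive degrees. -/
theorem exists_map_mul_eq (k s : ℕ) :
    ∃ s₁, s ≤ s₁ ∧ ∀ (g : (P s₁).Hom (P s)) {n : ℕ}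
      (A : Matrix (Fin (((P s₁).map σ).rk (k + 1))) (Fin n) R), ((P s₁).map σ).D k * A = 0 →
      ∃ B : Matrix (Fin (((P s).map σ).rk (k + 2))) (Fin n) R,
        ((P s).map σ).D (k + 1) * B = (g.map σ).f (k + 1) * A := by
  obtain ⟨s₁, hs, H⟩ := exists_act_D_eq hP k
    ((ModuleCat.restrictScalars σ).obj (ModuleCat.of R R)) s
  refine ⟨s₁, hs, fun g n A hA => Matrix.exists_mul_eq_of_forall_col _ _ fun j => ?_⟩
  obtain ⟨y, hy⟩ := H g (fun i => A i j) (congrArg (fun C => fun i => C i j) hA)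
  exact ⟨y, hy⟩

include hP in
/-- Lifting chain maps to the base changes of the resolutions, up to a given degree. -/
theorem exists_lift_map (k s : ℕ) :
    ∃ s₁, s ≤ s₁ ∧ ∀ Q : MatrixComplex R,
      (∃ B : Matrix (Fin (((P s₁).map σ).rk 1)) (Fin (Q.rk 1)) R, ((P s₁).map σ).D 0 * B = Q.D 0) →
      ∃ θ : ∀ j, Matrix (Fin (((P s).map σ).rk j)) (Fin (Q.rk j)) R,
        θ 0 = (1 : Matrix (Fin 1) (Fin 1) R) ∧
        (∀ j < k, θ j * Q.D j = ((P s).map σ).D j * θ (j + 1)) ∧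
        ∃ B : Matrix (Fin (((P s).map σ).rk (k + 1))) (Fin (Q.rk (k + 1))) R,
          ((P s).map σ).D k * B = θ k * Q.D k := by
  induction k generalizing s with
  | zero =>
    refine ⟨s, le_rfl, fun Q ⟨B, hB⟩ => ⟨fun | 0 => (1 : Matrix (Fin 1) (Fin 1) R) | j + 1 => 0, rfl,
      fun j hj => absurd hj (Nat.not_lt_zero _), B, hB.trans (Matrix.one_mul _).symm⟩⟩
  | succ k ih =>
    obtain ⟨s', hs', H'⟩ := exists_map_mul_eq σ hP k s
    obtain ⟨s₁, hs₁, H⟩ := ih s'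
    obtain ⟨c⟩ := exists_hom hP hs'
    refine ⟨s₁, hs'.trans hs₁, fun Q hQ => ?_⟩
    obtain ⟨θ, h0, hθ, B, hB⟩ := H Q hQ
    obtain ⟨B', hB'⟩ := H' c (B * Q.D (k + 1)) (by
      rw [← Matrix.mul_assoc, hB, Matrix.mul_assoc, Q.D_mul_D, Matrix.mul_zero])
    -- Up to degree `k`, the new lift is the old one pushed along the inverse system.
    refine ⟨Function.update (fun j => (c.map σ).f j * θ j) (k + 1) ((c.map σ).f (k + 1) * B),
      ?_, fun j hj => ?_, B', ?_⟩
    · rw [Function.update_of_ne (Nat.succ_ne_zero k).symm, h0, (c.map σ).zero]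
      exact Matrix.one_mul _
    · rw [Function.update_of_ne hj.ne]
      rcases (Nat.lt_succ_iff.1 hj).lt_or_eq with hj' | rfl
      · rw [Function.update_of_ne (by omega), Matrix.mul_assoc, hθ j hj', ← Matrix.mul_assoc,
          (c.map σ).comm, Matrix.mul_assoc]
      · rw [Function.update_self, Matrix.mul_assoc, ← hB, ← Matrix.mul_assoc, (c.map σ).comm,
          Matrix.mul_assoc]
    · rw [Function.update_self, hB', Matrix.mul_assoc]

include hP in
/-- A chain map to the base changes of the resolutions that vanishes in degree `0` becomes zero on
cohomology classes further along the inverse system. -/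
theorem exists_act_mul_mem_coboundaries (i s : ℕ) :
    ∃ s₁, s ≤ s₁ ∧ ∃ c : (P s₁).Hom (P s), ∀ (Q : MatrixComplex R)
      (f : ∀ j, Matrix (Fin (((P s₁).map σ).rk j)) (Fin (Q.rk j)) R), f 0 = 0 →
      (∀ j < i, f j * Q.D j = ((P s₁).map σ).D j * f (j + 1)) →
      ∀ (M : Type u) [AddCommGroup M] [Module R M] (z : Fin (((P s).map σ).rk i) → M),
        z ∈ ((P s).map σ).cocycles i M →
          (((c.map σ).f i * f i : Matrix (Fin (((P s).map σ).rk i)) (Fin (Q.rk i)) R)ᵀ).act M z ∈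
            Q.coboundaries M i := by
  cases i with
  | zero =>
    obtain ⟨c⟩ := exists_hom hP (le_refl s)
    refine ⟨s, le_rfl, c, fun Q f h0 _ M _ _ z _ => ?_⟩
    rw [h0, Matrix.mul_zero, Matrix.transpose_zero, Matrix.act_zero]
    exact zero_mem _
  | succ i =>
    suffices H : ∃ s₁, s ≤ s₁ ∧ ∃ c : (P s₁).Hom (P s), ∀ (Q : MatrixComplex R)
        (f : ∀ j, Matrix (Fin (((P s₁).map σ).rk j)) (Fin (Q.rk j)) R), f 0 = 0 →
        (∀ j < i + 1, f j * Q.D j = ((P s₁).map σ).D j * f (j + 1)) →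
        ∃ (a : Matrix (Fin (((P s).map σ).rk (i + 1))) (Fin (Q.rk i)) R)
          (b : Matrix (Fin (((P s).map σ).rk (i + 2))) (Fin (Q.rk (i + 1))) R),
          (c.map σ).f (i + 1) * f (i + 1) = ((P s).map σ).D (i + 1) * b + a * Q.D i by
      obtain ⟨s₁, hs, c, H⟩ := H
      refine ⟨s₁, hs, c, fun Q f h0 hf M _ _ z hz => ?_⟩
      obtain ⟨a, b, hab⟩ := H Q f h0 hf
      exact act_transpose_mem_coboundaries (P := (P s).map σ) hz hab
    induction i generalizing s with
    | zero =>
      obtain ⟨s₁, hs, H⟩ := exists_map_mul_eq σ hP 0 s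
      obtain ⟨c⟩ := exists_hom hP hs
      refine ⟨s₁, hs, c, fun Q f h0 hf => ?_⟩
      obtain ⟨b, hb⟩ := H c (f 1) (by rw [← hf 0 Nat.one_pos, h0, Matrix.zero_mul])
      exact ⟨0, b, by rw [hb, Matrix.zero_mul, add_zero]⟩
    | succ i ih =>
      obtain ⟨s', hs', H'⟩ := exists_map_mul_eq σ hP (i + 1) s
      obtain ⟨s₁, hs₁, c₁, H⟩ := ih s'
      obtain ⟨c⟩ := exists_hom hP hs'
      refine ⟨s₁, hs'.trans hs₁, c.comp c₁, fun Q f h0 hf => ?_⟩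
      obtain ⟨a, b, hab⟩ := H Q f h0 fun j hj => hf j (hj.trans (Nat.lt_succ_self _))
      obtain ⟨b', hb'⟩ := H' c ((c₁.map σ).f (i + 2) * f (i + 2) - b * Q.D (i + 1)) (by
        rw [Matrix.mul_sub, ← Matrix.mul_assoc, ← (c₁.map σ).comm, Matrix.mul_assoc,
          ← hf (i + 1) (Nat.lt_succ_self _), ← Matrix.mul_assoc, hab, Matrix.add_mul,
          Matrix.mul_assoc a, Q.D_mul_D, Matrix.mul_zero, add_zero, Matrix.mul_assoc, sub_self])
      refine ⟨(c.map σ).f (i + 2) * b, b', ?_⟩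
      have h1 : ((c.comp c₁).map σ).f (i + 2) = (c.map σ).f (i + 2) * (c₁.map σ).f (i + 2) :=
        Matrix.map_mul
      rw [h1, hb', Matrix.mul_sub, Matrix.mul_assoc, Matrix.mul_assoc, sub_add_cancel]

end Endomorphism

end MatrixComplex

/-! ### Local cohomology and restriction of scalars along a finite endomorphism -/

namespace MatrixComplex

section Comparison

variable {R : Type u} [CommRing R]

theorem Hom.act_mem_coboundaries {Q P : MatrixComplex R} (g : Q.Hom P) {M : Type u}
    [AddCommGroup M] [Module R M] {i : ℕ} {z : Fin (P.rk i) → M} (hz : z ∈ P.coboundaries M i) :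
    (g.f i)ᵀ.act M z ∈ Q.coboundaries M i := by
  cases i with
  | zero =>
    have h0 : z = 0 := hz
    rw [h0, map_zero]
    exact zero_mem _
  | succ i =>
    obtain ⟨y, rfl⟩ := hz
    refine ⟨(g.f i)ᵀ.act M y, ?_⟩
    rw [← Matrix.act_transpose_mul, ← Matrix.act_transpose_mul, g.comm]

theorem IsResolution.exists_map_D_zero_mul_eq {P : MatrixComplex R} {J : Ideal R}
    (h : P.IsResolution J) (σ : R →+* R) {n : Type*} [Fintype n] (A : Matrix (Fin 1) n R)
    (hA : ∀ j, A 0 j ∈ J.map σ) :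
    ∃ B : Matrix (Fin ((P.map σ).rk 1)) n R, (P.map σ).D 0 * B = A := by
  have key : J.map σ ≤ Submodule.comap (LinearMap.pi fun _ : Fin 1 => LinearMap.id)
      (LinearMap.range ((P.map σ).D 0).mulVecLin) := by
    rw [Ideal.map_le_iff_le_comap]
    intro r hr
    obtain ⟨y, hy⟩ := (h.exact_zero fun _ => r).1 hr
    refine ⟨fun j => σ (y j), ?_⟩
    ext i
    have h1 : σ (∑ j, P.D 0 i j * y j) = σ r := congrArg σ (congrFun hy i)
    rw [map_sum] at h1
    simp only [map_mul] at h1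
    exact h1
  refine Matrix.exists_mul_eq_of_forall_col _ _ fun j => ?_
  obtain ⟨y, hy⟩ := key (hA j)
  refine ⟨y, hy.trans ?_⟩
  ext i
  rw [Subsingleton.elim i 0]
  rfl

variable {I : Ideal R} {P : ℕ → MatrixComplex R} {σ : R →+* R}
  (hP : ∀ t, (P t).IsResolution (I ^ t)) (hσ : I.map σ ≤ I)

/-- The map from the base change along `σ` of the resolution of `R ⧸ I ^ t` to this resolution. -/
noncomputable def baseChangeHom (t : ℕ) : ((P t).map σ).Hom (P t) :=
  (hP t).lift fun j => by
    have h1 : (I ^ t).map σ ≤ I ^ t := by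
      rw [Ideal.map_pow]
      exact Ideal.pow_right_mono hσ t
    exact h1 (Ideal.mem_map_of_mem σ ((hP t).D_zero_mem _ j))

/-- The map on cocycles from coefficients in `M` to coefficients in the restriction of scalars of
`M` along `σ`. -/
noncomputable def restrictCocycle (t i : ℕ) (M : ModuleCat.{u} R) (z : (P t).cocycles i M) :
    (P t).cocycles i ((ModuleCat.restrictScalars σ).obj M) :=
  ⟨((baseChangeHom hP hσ t).f i)ᵀ.act M z.1, (mem_cocycles_restrictScalars σ).2
    ((baseChangeHom hP hσ t).act_mem_cocycles z.2)⟩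

theorem lcClass_eq_of_sub_mem {t i : ℕ} {M : ModuleCat.{u} R} (z z' : (P t).cocycles i M)
    (h : (z.1 - z'.1) ∈ (P t).coboundaries M i) : lcClass hP t i M z = lcClass hP t i M z' := by
  rw [← sub_eq_zero, ← map_sub]
  exact lcClass_eq_zero_of_mem hP _ h

theorem restrictCocycle_add (t i : ℕ) (M : ModuleCat.{u} R) (z z' : (P t).cocycles i M) :
    restrictCocycle hP hσ t i M (z + z') =
      restrictCocycle hP hσ t i M z + restrictCocycle hP hσ t i M z' :=
  Subtype.ext (map_add _ _ _)

theorem restrictCocycle_smul (t i : ℕ) (M : ModuleCat.{u} R) (r : R) (z : (P t).cocycles i M) :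
    restrictCocycle hP hσ t i M (σ r • z) = r • restrictCocycle hP hσ t i M z :=
  Subtype.ext (map_smul (((baseChangeHom hP hσ t).f i)ᵀ.act M) (σ r) z.1)

theorem lcClass_restrictCocycle_comp {s t : ℕ} (hst : t ≤ s) (i : ℕ) (g : (P s).Hom (P t))
    (M : ModuleCat.{u} R) (z : (P t).cocycles i M) :
    lcClass hP s i _ (restrictCocycle hP hσ s i M
        ⟨(g.f i)ᵀ.act M z.1, g.act_mem_cocycles z.2⟩) =
      lcClass hP t i _ (restrictCocycle hP hσ t i M z) := by
  refine (lcClass_eq_of_sub_mem hP _ _ ((mem_coboundaries_restrictScalars σ).2 ?_)).trans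
    (lcClass_comp hP hst i g _ (restrictCocycle hP hσ t i M z))
  have := (hP t).sub_mem_coboundaries (g.comp (baseChangeHom hP hσ s))
    ((baseChangeHom hP hσ t).comp (g.map σ)) i z.2
  rw [Hom.comp, Hom.comp, Matrix.act_transpose_mul, Matrix.act_transpose_mul] at this
  exact this

variable [IsNoetherianRing R]
  [Module.Finite R ((ModuleCat.restrictScalars σ).obj (ModuleCat.of R R))]
  (hcof : ∀ s, ∃ s', I ^ s' ≤ (I ^ s).map σ)

include hcof in
/-- `restrictCocycle` is well defined and injective on local cohomology classes. -/
theorem lcClass_restrictCocycle_eq_zero_iff (t i : ℕ) (M : ModuleCat.{u} R)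
    (z : (P t).cocycles i M) :
    lcClass hP t i _ (restrictCocycle hP hσ t i M z) = 0 ↔ lcClass hP t i M z = 0 := by
  constructor
  · intro h0
    obtain ⟨s, hs, H⟩ := exists_mem_coboundaries hP _ h0
    obtain ⟨g⟩ := exists_hom hP hs
    have h1 := (mem_coboundaries_restrictScalars σ).1 (H g)
    obtain ⟨s₁, hs₁, hlift⟩ := exists_lift_map σ hP i s
    obtain ⟨s', hs'⟩ := hcof s₁
    obtain ⟨θ, hθ0, hθ, -⟩ := hlift (P (s' + t))
      ((hP s₁).exists_map_D_zero_mul_eq σ _ fun j =>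
        hs' (Ideal.pow_le_pow_right (Nat.le_add_right _ _) ((hP (s' + t)).D_zero_mem _ j)))
    obtain ⟨g'⟩ := exists_hom hP (Nat.le_add_left t s')
    rw [← lcClass_comp hP (Nat.le_add_left t s') i g']
    apply lcClass_eq_zero_of_mem
    -- the composite of the lift with `baseChangeHom` is homotopic to `g'`
    let φ := (baseChangeHom hP hσ t).comp (g.map σ)
    have h2 := (hP t).act_mem_coboundaries (i := i) (Q := P (s' + t))
      (fun k => g'.f k - φ.f k * θ k)
      (by
        rw [hθ0, φ.zero, g'.zero]
        exact sub_eq_zero.2 (Matrix.one_mul _).symm)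
      (fun j hj => by
        rw [Matrix.sub_mul, Matrix.mul_sub, g'.comm, Matrix.mul_assoc, hθ j hj,
          ← Matrix.mul_assoc, φ.comm, Matrix.mul_assoc]) z.2
    rw [Matrix.transpose_sub, Matrix.act_sub] at h2
    have h3 : ((φ.f i * θ i)ᵀ).act M z.1 ∈ (P (s' + t)).coboundaries M i := by
      rw [Matrix.act_transpose_mul]
      have h4 : (φ.f i)ᵀ.act M z.1 ∈ ((P s).map σ).coboundaries M i := by
        change ((baseChangeHom hP hσ t).f i * (g.map σ).f i)ᵀ.act M z.1 ∈ _
        rw [Matrix.act_transpose_mul]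
        exact h1
      cases i with
      | zero =>
        have h0 : (φ.f 0)ᵀ.act M z.1 = 0 := h4
        rw [h0, map_zero]
        exact zero_mem _
      | succ i =>
        obtain ⟨y, hy⟩ := h4
        refine ⟨(θ i)ᵀ.act M y, ?_⟩
        rw [← hy, ← Matrix.act_transpose_mul, ← Matrix.act_transpose_mul,
          hθ i (Nat.lt_succ_self i)]
    simpa using add_mem h2 h3
  · intro h0
    obtain ⟨s, hs, H⟩ := exists_mem_coboundaries hP _ h0
    obtain ⟨g⟩ := exists_hom hP hs
    rw [← lcClass_restrictCocycle_comp hP hσ hs i g]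
    apply lcClass_eq_zero_of_mem
    exact (mem_coboundaries_restrictScalars σ).2
      ((baseChangeHom hP hσ s).act_mem_coboundaries (H g))

include hcof in
/-- Every local cohomology class of a restriction of scalars comes from `restrictCocycle`. -/
theorem exists_lcClass_restrictCocycle_eq (i : ℕ) (M : ModuleCat.{u} R)
    (x : (localCohomology I i).obj ((ModuleCat.restrictScalars σ).obj M)) :
    ∃ t z, lcClass hP t i _ (restrictCocycle hP hσ t i M z) = x := by
  obtain ⟨s, y, rfl⟩ := exists_lcClass_eq hP i _ x
  obtain ⟨s₁, hs₁, c, hc⟩ := exists_act_mul_mem_coboundaries σ hP i s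
  obtain ⟨s₂, hs₂, hlift⟩ := exists_lift_map σ hP (i + 1) s₁
  obtain ⟨s', hs'⟩ := hcof s₂
  obtain ⟨θ, hθ0, hθ, -⟩ := hlift (P (s' + s₁))
    ((hP s₂).exists_map_D_zero_mul_eq σ _ fun j =>
      hs' (Ideal.pow_le_pow_right (Nat.le_add_right _ _) ((hP (s' + s₁)).D_zero_mem _ j)))
  obtain ⟨g⟩ := exists_hom hP (Nat.le_add_left s₁ s')
  have hy : y.1 ∈ ((P s).map σ).cocycles i M := y.2
  let z : Fin ((P (s' + s₁)).rk i) → M := (θ i)ᵀ.act M (((c.map σ).f i)ᵀ.act M y.1)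
  have hz : z ∈ (P (s' + s₁)).cocycles i M := by
    rw [mem_cocycles, ← Matrix.act_transpose_mul, hθ i (Nat.lt_succ_self i),
      Matrix.act_transpose_mul, mem_cocycles.1 ((c.map σ).act_mem_cocycles hy), map_zero]
  refine ⟨s' + s₁, ⟨z, hz⟩, ?_⟩
  refine (lcClass_eq_of_sub_mem hP _ _ ((mem_coboundaries_restrictScalars σ).2 ?_)).trans
    (lcClass_comp hP (hs₁.trans (Nat.le_add_left s₁ s')) i (c.comp g) _ y)
  let φ := baseChangeHom hP hσ (s' + s₁)
  have h1 := hc ((P (s' + s₁)).map σ) (fun k => θ k * φ.f k - (g.map σ).f k)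
    (by
      rw [hθ0, φ.zero, (g.map σ).zero]
      exact sub_eq_zero.2 (Matrix.one_mul _))
    (fun j hj => by
      rw [Matrix.sub_mul, Matrix.mul_sub, Matrix.mul_assoc, φ.comm, ← Matrix.mul_assoc,
        hθ j (hj.trans (Nat.lt_succ_self i)), Matrix.mul_assoc, (g.map σ).comm]) M y.1 hy
  have e := Matrix.act_transpose_mul ((c.map σ).f i) (θ i * φ.f i - (g.map σ).f i) (N := M) y.1
  rw [Matrix.transpose_sub, Matrix.act_sub, Matrix.act_transpose_mul (θ i) (φ.f i)] at e
  have h2 : ((c.comp g).f i)ᵀ.act ((ModuleCat.restrictScalars σ).obj M) y.1 =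
      ((g.map σ).f i)ᵀ.act M (((c.map σ).f i)ᵀ.act M y.1) :=
    Matrix.act_transpose_mul (N := (ModuleCat.restrictScalars σ).obj M) (c.f i) (g.f i) y.1
  exact (congrArg (· ∈ ((P (s' + s₁)).map σ).coboundaries M i) (e.trans (congrArg
    (fun w : Fin (((P (s' + s₁)).map σ).rk i) → M => (φ.f i)ᵀ.act M z - w) h2.symm))).mp h1

include hcof in
/-- Local cohomology commutes with restriction of scalars along a finite endomorphism of the
ring. -/
theorem exists_comparison (i : ℕ) (M : ModuleCat.{u} R) :
    ∃ φ : (ModuleCat.restrictScalars σ).obj ((localCohomology I i).obj M) →ₗ[R]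
        (localCohomology I i).obj ((ModuleCat.restrictScalars σ).obj M),
      Function.Bijective φ ∧ ∀ t (z : (P t).cocycles i M), φ (lcClass hP t i M z) =
        lcClass hP t i _ (restrictCocycle hP hσ t i M z) := by
  have h0 := lcClass_restrictCocycle_eq_zero_iff hP hσ hcof
  choose t z hz using exists_lcClass_eq hP i M
  let f (x : (localCohomology I i).obj M) :
      (localCohomology I i).obj ((ModuleCat.restrictScalars σ).obj M) :=
    lcClass hP (t x) i _ (restrictCocycle hP hσ (t x) i M (z x))
  -- any two cocycles can be compared on a common resolution
  have lift : ∀ {s s'} (_ : s ≤ s') (w : (P s).cocycles i M), ∃ w' : (P s').cocycles i M,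
      lcClass hP s' i M w' = lcClass hP s i M w ∧
      lcClass hP s' i _ (restrictCocycle hP hσ s' i M w') =
        lcClass hP s i _ (restrictCocycle hP hσ s i M w) := by
    intro s s' hs w
    obtain ⟨g⟩ := exists_hom hP hs
    exact ⟨_, lcClass_comp hP hs i g M w, lcClass_restrictCocycle_comp hP hσ hs i g M w⟩
  have hf : ∀ s (w : (P s).cocycles i M), f (lcClass hP s i M w) =
      lcClass hP s i _ (restrictCocycle hP hσ s i M w) := by
    intro s w
    set x := lcClass hP s i M w with hx
    obtain ⟨w₁, h1, h1'⟩ := lift (Nat.le_add_left s (t x)) w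
    obtain ⟨w₂, h2, h2'⟩ := lift (Nat.le_add_right (t x) s) (z x)
    change lcClass hP (t x) i _ (restrictCocycle hP hσ (t x) i M (z x)) = _
    rw [← h1', ← h2']
    have h3 : lcClass hP (t x + s) i M (w₂ - w₁) = 0 := by
      rw [map_sub, h1, h2, hz, sub_self]
    have h4 : w₂ = (w₂ - w₁) + w₁ := (sub_add_cancel _ _).symm
    rw [h4, restrictCocycle_add, map_add, (h0 _ _ _ _).2 h3, zero_add]
  refine ⟨{ toFun := f, map_add' := fun x y => ?_, map_smul' := fun r x => ?_ }, ⟨?_, ?_⟩, hf⟩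
  · obtain ⟨s, w, rfl⟩ := exists_lcClass_eq hP i M x
    obtain ⟨s', w', rfl⟩ := exists_lcClass_eq hP i M y
    obtain ⟨w₁, h1, h1'⟩ := lift (Nat.le_add_right s s') w
    obtain ⟨w₂, h2, h2'⟩ := lift (Nat.le_add_left s' s) w'
    rw [hf, hf, ← h1', ← h2', ← map_add, ← restrictCocycle_add, ← hf, map_add, h1, h2]
    rfl
  · obtain ⟨s, w, rfl⟩ := exists_lcClass_eq hP i M x
    rw [hf, RingHom.id_apply, ← map_smul, ← restrictCocycle_smul, ← hf, map_smul]
    rfl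
  · rw [injective_iff_map_eq_zero]
    intro x hx
    obtain ⟨s, w, rfl⟩ := exists_lcClass_eq hP i M x
    exact (h0 _ _ _ _).1 ((hf s w).symm.trans hx)
  · intro y
    obtain ⟨s, w, rfl⟩ := exists_lcClass_restrictCocycle_eq hP hσ hcof i M y
    exact ⟨_, hf s w⟩

end Comparison

end MatrixComplex

/-! ### Frobenius pushforwards -/

section FrobeniusPushforward

variable {p : ℕ} [Fact p.Prime] {R : Type u} [CommRing R] [CharP R p]

variable (p) in
/-- The `e`-th Frobenius pushforward of a linear map. -/
noncomputable abbrev frobeniusPushforwardMap (e : ℕ) {M N : ModuleCat.{u} R} (f : M ⟶ N) :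
    frobeniusPushforward p e M ⟶ frobeniusPushforward p e N :=
  (ModuleCat.restrictScalars (iterateFrobenius R p e)).map f

/-- All Frobenius pushforwards of an `F`-finite ring are finite modules. -/
theorem IsFFinite.finite (hR : IsFFinite p R) (e : ℕ) :
    Module.Finite R (frobeniusPushforward p e (ModuleCat.of R R)) := by
  have h1 : (iterateFrobenius R p 1).Finite := hR.finite_pushforward
  change (iterateFrobenius R p e).Finite
  induction e with
  | zero =>
    rw [iterateFrobenius_zero]
    exact RingHom.Finite.id R
  | succ e ih =>
    have : iterateFrobenius R p (e + 1) =
        (iterateFrobenius R p 1).comp (iterateFrobenius R p e) := by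
      ext x
      rw [RingHom.comp_apply, iterateFrobenius_def, iterateFrobenius_def, iterateFrobenius_def,
        ← pow_mul, ← pow_add]
    rw [this]
    exact h1.comp ih

/-- Some power of `I` lies in the ideal generated by the `p ^ e`-th powers of elements of `I ^ s`. -/
theorem IsFFinite.exists_pow_le_map (hR : IsFFinite p R) (I : Ideal R) (e s : ℕ) :
    ∃ s', I ^ s' ≤ (I ^ s).map (iterateFrobenius R p e) := by
  have := hR.isNoetherianRing
  refine Ideal.exists_pow_le_of_le_radical_of_fg (fun x hx => ?_) (IsNoetherian.noetherian I)
  refine ⟨s * p ^ e, ?_⟩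
  rw [pow_mul, ← iterateFrobenius_def]
  exact Ideal.mem_map_of_mem _ (Ideal.pow_mem_pow hx s)

theorem map_iterateFrobenius_le_pow (I : Ideal R) {e t : ℕ} (h : t ≤ p ^ e) :
    I.map (iterateFrobenius R p e) ≤ I ^ t := by
  rw [Ideal.map_le_iff_le_comap]
  intro x hx
  rw [Ideal.mem_comap, iterateFrobenius_def]
  exact Ideal.pow_le_pow_right h (Ideal.pow_mem_pow hx _)

theorem map_iterateFrobenius_le (I : Ideal R) (e : ℕ) :
    I.map (iterateFrobenius R p e) ≤ I :=
  (map_iterateFrobenius_le_pow I (Nat.one_le_pow _ _ (Fact.out : p.Prime).pos)).trans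
    (pow_one I).le

end FrobeniusPushforward

namespace localCohomology

variable {R : Type u} [CommRing R]

section Linear

variable [IsNoetherianRing R]

open MatrixComplex

/-- A chosen resolution of `R ⧸ I ^ t` by finite free modules. -/
noncomputable def resolution (I : Ideal R) (t : ℕ) : MatrixComplex R :=
  (exists_isResolution (I ^ t)).choose

theorem isResolution (I : Ideal R) (t : ℕ) : (resolution I t).IsResolution (I ^ t) :=
  (exists_isResolution (I ^ t)).choose_spec

instance additive (I : Ideal R) (i : ℕ) : (localCohomology I i).Additive where
  map_add {M N f g} := by
    refine ModuleCat.hom_ext (LinearMap.ext fun x => ?_)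
    obtain ⟨t, z, rfl⟩ := exists_lcClass_eq (isResolution I) i M x
    rw [ModuleCat.hom_add, LinearMap.add_apply, map_lcClass, map_lcClass, map_lcClass, ← map_add]
    rfl

instance linear (I : Ideal R) (i : ℕ) : (localCohomology I i).Linear R where
  map_smul {M N} f r := by
    refine ModuleCat.hom_ext (LinearMap.ext fun x => ?_)
    obtain ⟨t, z, rfl⟩ := exists_lcClass_eq (isResolution I) i M x
    rw [ModuleCat.hom_smul, LinearMap.smul_apply, map_lcClass, map_lcClass, ← map_smul]
    rfl

/-- The image of `Ext^i(R ⧸ I, M)` in local cohomology. -/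
noncomputable def firstLevel (I : Ideal R) (i : ℕ) (M : ModuleCat.{u} R) :
    Submodule R ((localCohomology I i).obj M) :=
  LinearMap.range (lcClass (isResolution I) 1 i M)

theorem map_mem_firstLevel (I : Ideal R) (i : ℕ) {M N : ModuleCat.{u} R} (f : M ⟶ N)
    {x : (localCohomology I i).obj M} (hx : x ∈ firstLevel I i M) :
    ((localCohomology I i).map f).hom x ∈ firstLevel I i N := by
  obtain ⟨z, rfl⟩ := hx
  rw [map_lcClass]
  exact ⟨_, rfl⟩

theorem finite_firstLevel (I : Ideal R) (i : ℕ) (M : ModuleCat.{u} R) [Module.Finite R M] :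
    Module.Finite R (firstLevel I i M) := by
  have : IsNoetherian R M := isNoetherian_of_isNoetherianRing_of_finite R M
  exact Module.Finite.range _

end Linear

section Frobenius

variable {p : ℕ} [Fact p.Prime] [CharP R p]

open MatrixComplex

/-- Local cohomology commutes with Frobenius pushforward, and every class is moved by a large
Frobenius pushforward into the image of `Ext^i(R ⧸ I, -)`. -/
theorem exists_frobenius_comparison (hR : IsFFinite p R) (I : Ideal R) (i : ℕ) :
    have := hR.isNoetherianRing
    ∃ φ : ∀ (e : ℕ) (M : ModuleCat.{u} R),
      frobeniusPushforward p e ((localCohomology I i).obj M) ⟶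
        (localCohomology I i).obj (frobeniusPushforward p e M),
      (∀ e M, Function.Bijective (φ e M).hom) ∧
      (∀ e {M N : ModuleCat.{u} R} (f : M ⟶ N) (x : (localCohomology I i).obj M),
        (φ e N).hom (((localCohomology I i).map f).hom x) =
          ((localCohomology I i).map (frobeniusPushforwardMap p e f)).hom ((φ e M).hom x)) ∧
      ∀ (M : ModuleCat.{u} R) (x : (localCohomology I i).obj M),
        ∃ (N : Submodule R M) (e₀ : ℕ), N.FG ∧ ∀ e ≥ e₀,
          ∃ y ∈ firstLevel I i (frobeniusPushforward p e (ModuleCat.of R N)),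
            ((localCohomology I i).map (frobeniusPushforwardMap p e
              (ModuleCat.ofHom N.subtype))).hom y = (φ e M).hom x := by
  have := hR.isNoetherianRing
  have hfin : ∀ e, Module.Finite R ((ModuleCat.restrictScalars (iterateFrobenius R p e)).obj
    (ModuleCat.of R R)) := hR.finite
  have hP := isResolution I
  choose φ hφ hφ' using fun (e : ℕ) (M : ModuleCat.{u} R) => exists_comparison
    (σ := iterateFrobenius R p e) hP (map_iterateFrobenius_le I e) (hR.exists_pow_le_map I e) i M
  refine ⟨fun e M => ConcreteCategory.ofHom (φ e M), hφ, fun e M N f x => ?_, fun M x => ?_⟩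
  · obtain ⟨t, z, rfl⟩ := exists_lcClass_eq hP i M x
    rw [map_lcClass]
    refine (hφ' e N t _).trans (Eq.trans ?_ (congrArg ((localCohomology I i).map
      (frobeniusPushforwardMap p e f)).hom (hφ' e M t z).symm))
    refine Eq.trans ?_ (map_lcClass hP t i (frobeniusPushforwardMap p e f) _).symm
    refine congrArg _ (Subtype.ext ?_)
    exact Matrix.act_comp _ f.hom z.1
  · obtain ⟨t, z, rfl⟩ := exists_lcClass_eq hP i M x
    obtain ⟨g₀⟩ := exists_hom hP (Nat.le_succ t)
    rw [← lcClass_comp hP (Nat.le_succ t) i g₀]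
    generalize (⟨(g₀.f i)ᵀ.act M z.1, g₀.act_mem_cocycles z.2⟩ :
      (resolution I (t + 1)).cocycles i M) = z
    obtain ⟨g⟩ := exists_hom hP (Nat.le_add_left 1 t)
    -- The cocycle takes its values in a finitely generated submodule.
    let N : Submodule R M := Submodule.span R (Set.range z.1)
    let z' : Fin ((resolution I (t + 1)).rk i) → N :=
      fun j => ⟨z.1 j, Submodule.subset_span ⟨j, rfl⟩⟩
    have hz' : z' ∈ (resolution I (t + 1)).cocycles i N := by
      rw [mem_cocycles]
      ext j : 2
      exact (congrFun (Matrix.act_comp _ N.subtype z') j).symm.trans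
        (congrFun (mem_cocycles.1 z.2) j)
    refine ⟨N, t + 1, Submodule.fg_span (Set.finite_range _), fun e he => ?_⟩
    have hle : t + 1 ≤ p ^ e := he.le.trans (Nat.lt_pow_self (Fact.out : p.Prime).one_lt).le
    -- As `p ^ e ≥ t + 1`, the elements `x ^ p ^ e` with `x ∈ I` lie in `I ^ (t + 1)`.
    let κ : ((resolution I 1).map (iterateFrobenius R p e)).Hom (resolution I (t + 1)) :=
      (hP (t + 1)).lift fun j => by
        have h1 := (hP 1).D_zero_mem (0 : Fin 1) j
        rw [pow_one] at h1
        exact map_iterateFrobenius_le_pow I hle (Ideal.mem_map_of_mem _ h1)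
    let w : (resolution I 1).cocycles i (frobeniusPushforward p e (ModuleCat.of R N)) :=
      ⟨(κ.f i)ᵀ.act N z', (mem_cocycles_restrictScalars _).2 (κ.act_mem_cocycles hz')⟩
    refine ⟨_, ⟨w, rfl⟩, ?_⟩
    rw [map_lcClass]
    refine Eq.trans ?_ (hφ' e M (t + 1) z).symm
    rw [← lcClass_comp hP (Nat.le_add_left 1 t) i g]
    refine lcClass_eq_of_sub_mem hP _ _ ((mem_coboundaries_restrictScalars _).2 ?_)
    have h2 := (hP (t + 1)).sub_mem_coboundaries (κ.comp (g.map (iterateFrobenius R p e)))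
      (baseChangeHom hP (map_iterateFrobenius_le (p := p) I e) (t + 1)) i z.2
    rw [Hom.comp, Matrix.act_transpose_mul] at h2
    have h3 : (κ.f i)ᵀ.act M z.1 = fun j => N.subtype ((κ.f i)ᵀ.act N z' j) :=
      Matrix.act_comp _ N.subtype z'
    rw [h3] at h2
    exact h2

end Frobenius

end localCohomology

/-! ### Iterated local cohomology and Frobenius -/

section FrobeniusApproximation

variable (p : ℕ) [Fact p.Prime] {R : Type u} [CommRing R] [CharP R p]

/-- A functor `H` commutes with Frobenius pushforward and carries a functorial submodule `T M` of
`H M`, finitely generated for finitely generated `M`, such that each `x : H M` lands in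
`T (F^e_* M)` for all large `e`. -/
structure FrobeniusApproximation (H : ModuleCat.{u} R ⥤ ModuleCat.{u} R) where
  /-- The functorial submodule. -/
  T : ∀ M : ModuleCat.{u} R, Submodule R (H.obj M)
  /-- The comparison `F^e_* (H M) → H (F^e_* M)`. -/
  φ : ∀ (e : ℕ) (M : ModuleCat.{u} R),
    frobeniusPushforward p e (H.obj M) ⟶ H.obj (frobeniusPushforward p e M)
  map_mem : ∀ {M N : ModuleCat.{u} R} (f : M ⟶ N) {x : H.obj M}, x ∈ T M → (H.map f).hom x ∈ T N
  finite : ∀ (M : ModuleCat.{u} R) [Module.Finite R M], Module.Finite R (T M)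
  bijective : ∀ e M, Function.Bijective (φ e M).hom
  naturality : ∀ e {M N : ModuleCat.{u} R} (f : M ⟶ N) (x : H.obj M),
    (φ e N).hom ((H.map f).hom x) = (H.map (frobeniusPushforwardMap p e f)).hom ((φ e M).hom x)
  eventually_mem : ∀ (M : ModuleCat.{u} R) (x : H.obj M),
    ∀ᶠ e in Filter.atTop, (φ e M).hom x ∈ T (frobeniusPushforward p e M)

namespace FrobeniusApproximation

variable {p} {H : ModuleCat.{u} R ⥤ ModuleCat.{u} R}

/-- The condition `(φ e M).hom x ∈ T (F^e_* M)` is stable under the original action of `R` on `H M`,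
not only under that of `p ^ e`-th powers. -/
theorem smul_mem [H.Additive] [H.Linear R] (A : FrobeniusApproximation p H) {e : ℕ}
    {M : ModuleCat.{u} R} (r : R) {x : H.obj M} (hx : (A.φ e M).hom x ∈ A.T (frobeniusPushforward p e M)) :
    (A.φ e M).hom (r • x : H.obj M) ∈ A.T (frobeniusPushforward p e M) := by
  have h : (r • x : H.obj M) = (H.map (r • 𝟙 M)).hom x := by
    rw [Functor.map_smul, H.map_id]
    rfl
  rw [h]
  have := A.map_mem (frobeniusPushforwardMap p e (r • 𝟙 M)) hx
  rw [← A.naturality] at this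
  exact this

/-- For a finitely generated submodule of `H M`, a single exponent serves all its elements. -/
theorem eventually_forall_mem [H.Additive] [H.Linear R] (A : FrobeniusApproximation p H)
    {M : ModuleCat.{u} R} {N : Submodule R (H.obj M)} (hN : N.FG) :
    ∀ᶠ e in Filter.atTop, ∀ x ∈ N, (A.φ e M).hom x ∈ A.T (frobeniusPushforward p e M) := by
  obtain ⟨S, rfl⟩ := hN
  filter_upwards [(Filter.eventually_all_finset S).2 fun x _ => A.eventually_mem M x] with e he x hx
  induction hx using Submodule.span_induction with
  | mem x hx => exact he x hx
  | zero => exact (map_zero (A.φ e M).hom).symm ▸ zero_mem _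
  | add x y _ _ hx hy => exact (map_add (A.φ e M).hom x y).symm ▸ add_mem hx hy
  | smul r x _ hx => exact A.smul_mem r hx

variable (p R) in
/-- The identity functor, with `T M = M`. -/
noncomputable def id : FrobeniusApproximation p (𝟭 (ModuleCat.{u} R)) where
  T _ := ⊤
  φ _ _ := 𝟙 _
  map_mem _ _ _ := Submodule.mem_top
  finite M _ := Module.Finite.equiv (Submodule.topEquiv (R := R) (M := M)).symm
  bijective _ _ := Function.bijective_id
  naturality _ _ _ _ _ := rfl
  eventually_mem _ _ := Filter.Eventually.of_forall fun _ => Submodule.mem_top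

open localCohomology in
/-- The inductive step: `T` for `H^i_I ∘ H` is the image of `Ext^i(R ⧸ I, T M)`. -/
theorem nonempty_comp_localCohomology [H.Additive] [H.Linear R] (hR : IsFFinite p R)
    (A : FrobeniusApproximation p H) (I : Ideal R) (i : ℕ) :
    Nonempty (FrobeniusApproximation p (H ⋙ localCohomology I i)) := by
  have := hR.isNoetherianRing
  obtain ⟨φ, hφ, hnat, hex⟩ := exists_frobenius_comparison hR I i
  refine ⟨{
    T := fun M => (firstLevel I i (ModuleCat.of R (A.T M))).map
      ((localCohomology I i).map (ModuleCat.ofHom (A.T M).subtype)).hom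
    φ := fun e M => φ e (H.obj M) ≫ (localCohomology I i).map (A.φ e M)
    map_mem := ?_
    finite := ?_
    bijective := ?_
    naturality := ?_
    eventually_mem := ?_ }⟩
  · rintro M N f _ ⟨y, hy, rfl⟩
    let g : ModuleCat.of R (A.T M) ⟶ ModuleCat.of R (A.T N) :=
      ModuleCat.ofHom ((H.map f).hom.restrict fun x hx => A.map_mem f hx)
    refine ⟨_, map_mem_firstLevel I i g hy, ?_⟩
    have hg : g ≫ ModuleCat.ofHom (A.T N).subtype =
      ModuleCat.ofHom (A.T M).subtype ≫ H.map f := rfl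
    have := congrArg (localCohomology I i).map hg
    rw [Functor.map_comp, Functor.map_comp] at this
    exact congrArg (fun k => k.hom y) this
  · intro M _
    have := A.finite M
    have : Module.Finite R (ModuleCat.of R (A.T M)) := this
    have := finite_firstLevel I i (ModuleCat.of R (A.T M))
    exact Module.Finite.map _ _
  · intro e M
    have : IsIso (A.φ e M) := (ConcreteCategory.isIso_iff_bijective _).2 (A.bijective e M)
    have : IsIso (φ e (H.obj M)) := (ConcreteCategory.isIso_iff_bijective _).2 (hφ e (H.obj M))
    exact ConcreteCategory.bijective_of_isIso (φ e (H.obj M) ≫ (localCohomology I i).map (A.φ e M))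
  · intro e M N f x
    have h : frobeniusPushforwardMap p e (H.map f) ≫ A.φ e N =
        A.φ e M ≫ H.map (frobeniusPushforwardMap p e f) :=
      ModuleCat.hom_ext (LinearMap.ext fun x => A.naturality e f x)
    have h' := congrArg (localCohomology I i).map h
    rw [Functor.map_comp, Functor.map_comp] at h'
    exact (congrArg _ (hnat e (H.map f) x)).trans
      (congrArg (fun k => k.hom ((φ e (H.obj M)).hom x)) h')
  · intro M x
    obtain ⟨N, e₀, hN, hN'⟩ := hex (H.obj M) x
    filter_upwards [A.eventually_forall_mem hN, Filter.eventually_ge_atTop e₀] with e he he₀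
    obtain ⟨y, hy, hyx⟩ := hN' e he₀
    -- For large `e`, the comparison map carries the finitely generated `N ≤ H M` into `T`.
    let g : frobeniusPushforward p e (ModuleCat.of R N) ⟶
        ModuleCat.of R (A.T (frobeniusPushforward p e M)) :=
      ConcreteCategory.ofHom ((frobeniusPushforwardMap p e (ModuleCat.ofHom N.subtype) ≫
        A.φ e M).hom.codRestrict _ fun n => he n.1 n.2)
    refine ⟨_, map_mem_firstLevel I i g hy, ?_⟩
    have hg : g ≫ ModuleCat.ofHom (A.T (frobeniusPushforward p e M)).subtype =
      frobeniusPushforwardMap p e (ModuleCat.ofHom N.subtype) ≫ A.φ e M := rfl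
    have h' := congrArg (localCohomology I i).map hg
    rw [Functor.map_comp, Functor.map_comp] at h'
    have h₁ := congrArg (fun k => k.hom y) h'
    exact h₁.trans (congrArg ((localCohomology I i).map (A.φ e M)).hom hyx)

end FrobeniusApproximation

instance iteratedLocalCohomology.additive [IsNoetherianRing R] (L : List (Ideal R × ℕ)) :
    (iteratedLocalCohomology L).Additive := by
  induction L with
  | nil => exact inferInstanceAs (𝟭 (ModuleCat.{u} R)).Additive
  | cons a L ih =>
    exact inferInstanceAs (iteratedLocalCohomology L ⋙ localCohomology a.1 a.2).Additive

instance iteratedLocalCohomology.linear [IsNoetherianRing R] (L : List (Ideal R × ℕ)) :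
    (iteratedLocalCohomology L).Linear R := by
  induction L with
  | nil => exact inferInstanceAs ((𝟭 (ModuleCat.{u} R)).Linear R)
  | cons a L ih =>
    exact inferInstanceAs ((iteratedLocalCohomology L ⋙ localCohomology a.1 a.2).Linear R)

variable {p} in
theorem IsFFinite.nonempty_frobeniusApproximation (hR : IsFFinite p R) (L : List (Ideal R × ℕ)) :
    Nonempty (FrobeniusApproximation p (iteratedLocalCohomology L)) := by
  have := hR.isNoetherianRing
  induction L with
  | nil => exact ⟨FrobeniusApproximation.id p R⟩
  | cons a L ih =>
    obtain ⟨A⟩ := ih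
    exact A.nonempty_comp_localCohomology hR a.1 a.2

end FrobeniusApproximation

/-! ### Additive generation by Frobenius pushforwards of smaller exponent -/

section FactorsBelow

variable (p : ℕ) [Fact p.Prime] (A : Type u) [CommRing A] [CharP A p]

/-- The Frobenius pushforward `F^e_* A` of the ring itself. -/
noncomputable abbrev frobeniusRing (e : ℕ) : ModuleCat.{u} A :=
  frobeniusPushforward p e (ModuleCat.of A A)

/-- The endomorphisms of `F^e_* A` that are sums of maps factoring through some `F^{e'}_* A` with
`e' < e`. -/
noncomputable def factorsBelow (e : ℕ) : Submodule A (Module.End A (frobeniusRing p A e)) :=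
  Submodule.span A {g | ∃ e' < e, ∃ (α : frobeniusRing p A e →ₗ[A] frobeniusRing p A e')
    (β : frobeniusRing p A e' →ₗ[A] frobeniusRing p A e), g = β ∘ₗ α}

namespace factorsBelow

variable {p A} {e : ℕ}

theorem comp_mem {g : Module.End A (frobeniusRing p A e)} (hg : g ∈ factorsBelow p A e)
    (h : Module.End A (frobeniusRing p A e)) : g ∘ₗ h ∈ factorsBelow p A e := by
  induction hg using Submodule.span_induction with
  | mem g hg =>
    obtain ⟨e', he', α, β, rfl⟩ := hg
    exact Submodule.subset_span ⟨e', he', α ∘ₗ h, β, LinearMap.comp_assoc _ _ _⟩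
  | zero => exact zero_mem (factorsBelow p A e)
  | add f g _ _ hf hg => exact add_mem hf hg
  | smul r g _ hg => exact Submodule.smul_mem _ r hg

theorem mem_comp {g : Module.End A (frobeniusRing p A e)} (hg : g ∈ factorsBelow p A e)
    (h : Module.End A (frobeniusRing p A e)) : h ∘ₗ g ∈ factorsBelow p A e := by
  induction hg using Submodule.span_induction with
  | mem g hg =>
    obtain ⟨e', he', α, β, rfl⟩ := hg
    exact Submodule.subset_span ⟨e', he', α, h ∘ₗ β, (LinearMap.comp_assoc _ _ _).symm⟩
  | zero =>
    rw [LinearMap.comp_zero]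
    exact zero_mem _
  | add f g _ _ hf hg =>
    rw [LinearMap.comp_add]
    exact add_mem hf hg
  | smul r g _ hg =>
    rw [LinearMap.comp_smul]
    exact Submodule.smul_mem _ r hg

end factorsBelow

variable {A}

/-- Multiplication by an element of `A`, as an endomorphism of `F^e_* A`. -/
noncomputable def frobeniusRing.mul (e : ℕ) (a : A) : Module.End A (frobeniusRing p A e) :=
  (frobeniusPushforwardMap p e (ModuleCat.ofHom (LinearMap.mulLeft A a))).hom

variable {p}

namespace frobeniusRing

variable {e e' e'' : ℕ}

/-- The additive map `A → A` underlying a linear map between Frobenius pushforwards of `A`. -/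
noncomputable def toAddHom (α : frobeniusRing p A e →ₗ[A] frobeniusRing p A e') : A →+ A :=
  α.toAddMonoidHom

theorem toAddHom_pow_mul (α : frobeniusRing p A e →ₗ[A] frobeniusRing p A e') (r x : A) :
    toAddHom α (r ^ p ^ e * x) = r ^ p ^ e' * toAddHom α x :=
  α.map_smul r x

/-- An additive map `f : A → A` with `f (r ^ p ^ e * x) = r ^ p ^ e' * f x`, as a linear map
`F^e_* A → F^{e'}_* A`. -/
noncomputable def ofAddHom (f : A →+ A) (hf : ∀ r x, f (r ^ p ^ e * x) = r ^ p ^ e' * f x) :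
    frobeniusRing p A e →ₗ[A] frobeniusRing p A e' where
  toFun := f
  map_add' := map_add f
  map_smul' := hf

theorem toAddHom_comp (β : frobeniusRing p A e' →ₗ[A] frobeniusRing p A e'')
    (α : frobeniusRing p A e →ₗ[A] frobeniusRing p A e') (x : A) :
    toAddHom (β ∘ₗ α) x = toAddHom β (toAddHom α x) := rfl

theorem toAddHom_add (α β : frobeniusRing p A e →ₗ[A] frobeniusRing p A e') (x : A) :
    toAddHom (α + β) x = toAddHom α x + toAddHom β x := rfl

theorem toAddHom_sub (α β : frobeniusRing p A e →ₗ[A] frobeniusRing p A e') (x : A) :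
    toAddHom (α - β) x = toAddHom α x - toAddHom β x := rfl

theorem toAddHom_zero (x : A) :
    toAddHom (0 : frobeniusRing p A e →ₗ[A] frobeniusRing p A e') x = 0 := rfl

theorem toAddHom_one (x : A) :
    toAddHom (1 : Module.End A (frobeniusRing p A e)) x = x := rfl

theorem toAddHom_smul (r : A) (α : frobeniusRing p A e →ₗ[A] frobeniusRing p A e') (x : A) :
    toAddHom (r • α) x = r ^ p ^ e' * toAddHom α x := rfl

theorem toAddHom_mul (a x : A) : toAddHom (mul p e a) x = a * x := rfl

theorem ext {α β : frobeniusRing p A e →ₗ[A] frobeniusRing p A e'}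
    (h : ∀ x, toAddHom α x = toAddHom β x) : α = β := LinearMap.ext h

/-- A linear map between Frobenius pushforwards remains linear after one more pushforward. -/
noncomputable def succMap (α : frobeniusRing p A e →ₗ[A] frobeniusRing p A e') :
    frobeniusRing p A (e + 1) →ₗ[A] frobeniusRing p A (e' + 1) :=
  ofAddHom (toAddHom α) fun r x => by
    rw [pow_succ', pow_mul, toAddHom_pow_mul, ← pow_mul, ← pow_succ']

end frobeniusRing

theorem factorsBelow.succMap_mem {e : ℕ} {g : Module.End A (frobeniusRing p A e)}
    (hg : g ∈ factorsBelow p A e) : frobeniusRing.succMap g ∈ factorsBelow p A (e + 1) := by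
  induction hg using Submodule.span_induction with
  | mem g hg =>
    obtain ⟨e', he', α, β, rfl⟩ := hg
    exact Submodule.subset_span ⟨e' + 1, Nat.succ_lt_succ he', frobeniusRing.succMap α,
      frobeniusRing.succMap β, rfl⟩
  | zero => exact zero_mem (factorsBelow p A (e + 1))
  | add f g _ _ hf hg => exact add_mem hf hg
  | smul r g _ hg => exact mem_comp hg (frobeniusRing.mul p (e + 1) (r ^ p ^ e))

variable (p A) in
/-- The ideal of those `c` for which multiplication by `c` on `F^e_* A` is a sum of maps factoring
through some `F^{e'}_* A` with `e' < e`. -/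
noncomputable def factorsBelowIdeal (e : ℕ) : Ideal A :=
  (factorsBelow p A e).comap (LinearMap.toSpanSingleton A _ 1)

theorem mem_factorsBelowIdeal {e : ℕ} {c : A} :
    c ∈ factorsBelowIdeal p A e ↔
      c • (1 : Module.End A (frobeniusRing p A e)) ∈ factorsBelow p A e := Iff.rfl

/-- A sum of factorizations for `F^e_* A` is also one for `F^{e+1}_* A`. -/
theorem monotone_factorsBelowIdeal : Monotone (factorsBelowIdeal p A) := by
  refine monotone_nat_of_le_succ fun e c hc => ?_
  rw [mem_factorsBelowIdeal] at hc ⊢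
  -- `c ^ p ^ (e + 1)` is a multiple of `c ^ p ^ e`.
  have h := factorsBelow.mem_comp (factorsBelow.succMap_mem hc)
    (frobeniusRing.mul p (e + 1) (c ^ (p ^ (e + 1) - p ^ e)))
  convert h using 1
  refine frobeniusRing.ext fun x => ?_
  have hle : p ^ e ≤ p ^ (e + 1) := Nat.pow_le_pow_right (Fact.out : p.Prime).pos e.le_succ
  rw [frobeniusRing.toAddHom_smul, frobeniusRing.toAddHom_comp, frobeniusRing.toAddHom_mul]
  change _ = _ * (c ^ p ^ e * x)
  rw [← mul_assoc, ← pow_add, Nat.sub_add_cancel hle]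
  rfl

/-- Under finite `F`-representation type, all indecomposable summands of `F^e_* A` for large `e` are
already summands of some `F^{e'}_* A` with `e' < e`. -/
theorem HasFFRT.exists_one_mem_factorsBelow (h : HasFFRT p A) :
    ∃ e, (1 : Module.End A (frobeniusRing p A e)) ∈ factorsBelow p A e := by
  classical
  obtain ⟨s, M, -, h⟩ := h
  choose n φ using h
  -- An exponent at which `M i` occurs, if there is one.
  let f : Fin s → ℕ := fun i => if h : ∃ e, 0 < n e i then h.choose else 0
  have hf : ∀ i e, 0 < n e i → 0 < n (f i) i := by
    intro i e he
    have h : ∃ e, 0 < n e i := ⟨e, he⟩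
    simp only [f, dif_pos h]
    exact h.choose_spec
  obtain ⟨e, he⟩ : ∃ e, ∀ i, f i < e :=
    ⟨Finset.univ.sup f + 1, fun i => Nat.lt_succ_of_le (Finset.le_sup (Finset.mem_univ i))⟩
  refine ⟨e, ?_⟩
  obtain ⟨ψ⟩ := φ e
  let pr : ∀ (e : ℕ) (i : Fin s) (j : Fin (n e i)), ((i : Fin s) → Fin (n e i) → M i) →ₗ[A] M i :=
    fun e i j => LinearMap.proj j ∘ₗ LinearMap.proj i
  let inc : ∀ (e : ℕ) (i : Fin s) (j : Fin (n e i)), M i →ₗ[A] ((i : Fin s) → Fin (n e i) → M i) :=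
    fun e i j => LinearMap.single A (fun i => Fin (n e i) → M i) i ∘ₗ LinearMap.single A (fun _ => M i) j
  have hinc : ∀ e i j x, pr e i j (inc e i j x) = x := by
    intro e i j x
    simp [pr, inc]
  have hsum : (1 : Module.End A (frobeniusRing p A e)) =
      ∑ i, ∑ j, (ψ.symm.toLinearMap ∘ₗ inc e i j) ∘ₗ (pr e i j ∘ₗ ψ.toLinearMap) := by
    refine LinearMap.ext fun x => ψ.injective ?_
    simp only [LinearMap.sum_apply, map_sum, LinearMap.comp_apply, LinearEquiv.coe_coe,
      LinearEquiv.apply_symm_apply, Module.End.one_apply]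
    refine (Finset.univ_sum_single (ψ x)).symm.trans (Finset.sum_congr rfl fun i _ => ?_)
    refine Eq.trans ?_ (map_sum (LinearMap.single A (fun i => Fin (n e i) → M i) i) _ _)
    exact congrArg _ (Finset.univ_sum_single (ψ x i)).symm
  rw [hsum]
  refine Submodule.sum_mem _ fun i _ => Submodule.sum_mem _ fun j _ => ?_
  let k : Fin (n (f i) i) := ⟨0, hf i e (Nat.zero_lt_of_lt j.2)⟩
  obtain ⟨χ⟩ := φ (f i)
  refine Submodule.subset_span ⟨f i, he i,
    χ.symm.toLinearMap ∘ₗ inc (f i) i k ∘ₗ pr e i j ∘ₗ ψ.toLinearMap,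
    ψ.symm.toLinearMap ∘ₗ inc e i j ∘ₗ pr (f i) i k ∘ₗ χ.toLinearMap, ?_⟩
  refine LinearMap.ext fun x => ?_
  simp only [LinearMap.comp_apply, LinearEquiv.coe_coe, LinearEquiv.apply_symm_apply, hinc]

end FactorsBelow

/-! ### Descent of additive generation along flat ring extensions -/

open scoped TensorProduct in
/-- A semilinear map from a finitely presented module to a flat module is a linear combination
of semilinear functionals. -/
theorem Module.Flat.exists_eq_sum_smul {A B M N : Type*} [CommRing A] [CommRing B]
    [AddCommGroup M] [Module A M] [Module.FinitePresentation A M] [AddCommGroup N] [Module B N]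
    [Module.Flat B N] (σ : A →+* B) (h : M →ₛₗ[σ] N) :
    ∃ (k : ℕ) (α : Fin k → M →ₛₗ[σ] B) (s : Fin k → N), ∀ x, h x = ∑ j, α j x • s j := by
  let := σ.toAlgebra
  let : Module A N := Module.compHom N σ
  have : IsScalarTower A B N := ⟨fun a b n => mul_smul (σ a) b n⟩
  -- A semilinear map is the same as a linear map from the base change of `M`.
  let h' : M →ₗ[A] N :=
    { toFun := h, map_add' := map_add h, map_smul' := fun a x => h.map_smulₛₗ a x }
  obtain ⟨k, g₁, g₂, hg⟩ := Module.Flat.exists_factorization_of_finitePresentation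
    (h'.liftBaseChange B)
  refine ⟨k, fun j =>
    { toFun := fun x => g₁ (1 ⊗ₜ x) j
      map_add' := fun x y => by rw [TensorProduct.tmul_add, map_add, Finsupp.add_apply]
      map_smul' := fun a x => ?_ }, fun j => g₂ (Finsupp.single j 1), fun x => ?_⟩
  · have : (1 : B) ⊗ₜ[A] (a • x) = σ a • ((1 : B) ⊗ₜ[A] x) := by
      rw [TensorProduct.tmul_smul, ← algebraMap_smul B a]
      rfl
    rw [this, map_smul, Finsupp.smul_apply]
  · have h₁ : h x = g₂ (g₁ (1 ⊗ₜ x)) := by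
      have := LinearMap.congr_fun hg ((1 : B) ⊗ₜ[A] x)
      rw [LinearMap.liftBaseChange_tmul, one_smul] at this
      exact this
    rw [h₁]
    conv_lhs => rw [← Finsupp.univ_sum_single (g₁ (1 ⊗ₜ x)), map_sum]
    refine Finset.sum_congr rfl fun j _ => ?_
    rw [← map_smul, Finsupp.smul_single, smul_eq_mul, mul_one]
    rfl

section Descent

variable {p : ℕ} [Fact p.Prime] {R : Type u} [CommRing R] [CharP R p]

/-- The ideal generated by the `p ^ e`-th powers of elements of `I` lies in `I • F^e_* R`. -/
theorem mem_smul_top_of_mem_map_iterateFrobenius {I : Ideal R} {e : ℕ} {y : R}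
    (hy : y ∈ I.map (iterateFrobenius R p e)) :
    (show frobeniusRing p R e from y) ∈ (I • ⊤ : Submodule R (frobeniusRing p R e)) := by
  rw [Ideal.map] at hy
  induction hy using Submodule.span_induction with
  | mem y hy =>
    obtain ⟨a, ha, rfl⟩ := hy
    have : a • (show frobeniusRing p R e from (1 : R)) = iterateFrobenius R p e a := mul_one (_ : R)
    rw [← this]
    exact Submodule.smul_mem_smul ha Submodule.mem_top
  | zero => exact zero_mem (I • ⊤ : Submodule R (frobeniusRing p R e))
  | add x y _ _ hx hy => exact add_mem hx hy
  | smul r y _ hy =>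
    have h := Submodule.mem_map_of_mem (f := frobeniusRing.mul p e r) hy
    rw [Submodule.map_smul''] at h
    exact Submodule.smul_mono le_rfl le_top h

/-- An endomorphism congruent to `d` modulo `factorsBelow` whose image lies in `𝔭 • F^e_* R`, with
`d ∉ 𝔭`, satisfies a Cayley–Hamilton equation whose value at `d` is not in `𝔭`. -/
theorem exists_mem_factorsBelowIdeal_of_range_le {e : ℕ} (hR : IsFFinite p R) (𝔭 : Ideal R)
    [𝔭.IsPrime] {f : Module.End R (frobeniusRing p R e)} {d : R} (hd : d ∉ 𝔭)
    (hf : LinearMap.range f ≤ 𝔭 • ⊤) (hfd : f - d • 1 ∈ factorsBelow p R e) :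
    ∃ c ∈ factorsBelowIdeal p R e, c ∉ 𝔭 := by
  have := hR.finite e
  obtain ⟨P, hP, -, hcoeff, hPf⟩ :=
    LinearMap.exists_monic_and_natDegree_eq_and_coeff_mem_pow_and_aeval_eq_zero R f 𝔭 hf
  refine ⟨P.eval d, ?_, fun h => hd ?_⟩
  · obtain ⟨Q, hQ⟩ := P.X_sub_C_dvd_sub_C_eval (a := d)
    have h := congrArg (Polynomial.aeval f) hQ
    rw [map_sub, map_mul, map_sub, Polynomial.aeval_X, Polynomial.aeval_C, Polynomial.aeval_C, hPf,
      Algebra.algebraMap_eq_smul_one, Algebra.algebraMap_eq_smul_one, zero_sub] at h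
    rw [mem_factorsBelowIdeal, ← neg_mem_iff, h]
    exact factorsBelow.comp_mem hfd _
  · rw [Polynomial.eval_eq_sum_range, Finset.sum_range_succ, hP.coeff_natDegree, one_mul] at h
    refine Ideal.IsPrime.mem_of_pow_mem inferInstance P.natDegree ?_
    refine (Ideal.add_mem_iff_right _ (Ideal.sum_mem _ fun i hi => ?_)).1 h
    rw [Finset.mem_range] at hi
    exact Ideal.mul_mem_right _ _ (Ideal.pow_le_self (Nat.sub_pos_of_lt hi).ne' (hcoeff i))

variable {S : Type u} [CommRing S] [Algebra R S]

open frobeniusRing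

/-- Linear maps `F^e_* R → F^{e'}_* S` are linear combinations, with coefficients in `S`, of linear
maps `F^e_* R → F^{e'}_* R`. -/
theorem frobeniusRing.exists_eq_sum (hR : IsFFinite p R) [Module.Flat R S] {e e' : ℕ} (h : R →+ S)
    (hh : ∀ r x, h (r ^ p ^ e * x) = algebraMap R S (r ^ p ^ e') * h x) :
    ∃ (k : ℕ) (α : Fin k → frobeniusRing p R e →ₗ[R] frobeniusRing p R e') (s : Fin k → S),
      ∀ x : R, h x = ∑ j, s j * algebraMap R S (toAddHom (α j) x) := by
  have := hR.isNoetherianRing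
  have := hR.finite e
  have := Module.finitePresentation_of_finite R (frobeniusRing p R e)
  let h' : frobeniusRing p R e →ₛₗ[iterateFrobenius R p e'] S :=
    { toFun := h
      map_add' := map_add h
      map_smul' := fun r x => (hh r x).trans (Algebra.smul_def _ _).symm }
  obtain ⟨k, α, s, hs⟩ := Module.Flat.exists_eq_sum_smul _ h'
  refine ⟨k, fun j =>
    { toFun := α j, map_add' := map_add (α j), map_smul' := (α j).map_smulₛₗ }, s, fun x => ?_⟩
  refine (hs x).trans (Finset.sum_congr rfl fun j _ => ?_)
  rw [Algebra.smul_def, mul_comm]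
  rfl

variable [CharP S p]

/-- The restriction to `R` of an endomorphism of `F^e_* S` that is additively generated below `e`
is an `S`-linear combination of endomorphisms of `F^e_* R` additively generated below `e`. -/
theorem factorsBelow.restrict_mem_span (hR : IsFFinite p R) [Module.Flat R S] {e : ℕ}
    {g : Module.End S (frobeniusRing p S e)} (hg : g ∈ factorsBelow p S e) :
    (fun x : R => toAddHom g (algebraMap R S x)) ∈
      Submodule.span S {f : R → S | ∃ γ ∈ factorsBelow p R e,
        ∀ x : R, f x = algebraMap R S (toAddHom γ x)} := by
  induction hg using Submodule.span_induction with
  | mem g hg =>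
    obtain ⟨e', he', α, β, rfl⟩ := hg
    obtain ⟨k, a, s, ha⟩ := frobeniusRing.exists_eq_sum hR (e := e) (e' := e')
      ((toAddHom α).comp (algebraMap R S).toAddMonoidHom) fun r x => by
        change toAddHom α (algebraMap R S (r ^ p ^ e * x)) =
          algebraMap R S (r ^ p ^ e') * toAddHom α (algebraMap R S x)
        rw [map_mul, map_pow, map_pow, toAddHom_pow_mul]
    choose l b t hb using fun j => frobeniusRing.exists_eq_sum hR (e := e') (e' := e)
      ((toAddHom β).comp ((AddMonoidHom.mulLeft (s j)).comp (algebraMap R S).toAddMonoidHom))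
      fun r x => by
        change toAddHom β (s j * algebraMap R S (r ^ p ^ e' * x)) =
          algebraMap R S (r ^ p ^ e) * toAddHom β (s j * algebraMap R S x)
        rw [map_mul (algebraMap R S), map_pow, map_pow, mul_left_comm, toAddHom_pow_mul]
    have key : (fun x : R => toAddHom (β ∘ₗ α) (algebraMap R S x)) =
        ∑ j, ∑ i, t j i • fun x : R => algebraMap R S (toAddHom (b j i ∘ₗ a j) x) := by
      funext x
      simp only [Finset.sum_apply, Pi.smul_apply, smul_eq_mul, toAddHom_comp]
      refine (congrArg (toAddHom β) (ha x)).trans ((map_sum (toAddHom β) _ _).trans ?_)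
      exact Finset.sum_congr rfl fun j _ => hb j _
    rw [key]
    exact Submodule.sum_mem _ fun j _ => Submodule.sum_mem _ fun i _ => Submodule.smul_mem _ _
      (Submodule.subset_span ⟨_, Submodule.subset_span ⟨e', he', a j, b j i, rfl⟩, fun _ => rfl⟩)
  | zero => exact zero_mem (Submodule.span S {f : R → S | ∃ γ ∈ factorsBelow p R e,
      ∀ x : R, f x = algebraMap R S (toAddHom γ x)})
  | add f g _ _ hf hg => exact add_mem hf hg
  | smul r g _ hg => exact Submodule.smul_mem _ (r ^ p ^ e) hg

/-- Descent of additive generation: if the flat `R`-algebra `S` is additively generated below `e`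
and `R ⧸ J → S ⧸ J S`, for `J = 𝔭^{[p^e]}`, becomes bijective after localization at `𝔭`, then `R` is
additively generated below `e` near `𝔭`. -/
theorem exists_mem_factorsBelowIdeal (hR : IsFFinite p R) [Module.Flat R S] {e : ℕ}
    (h1 : (1 : Module.End S (frobeniusRing p S e)) ∈ factorsBelow p S e) (𝔭 : Ideal R) [𝔭.IsPrime]
    (hsurj : ∀ s : S, ∃ u ∉ 𝔭, ∃ a : R, algebraMap R S u * s - algebraMap R S a ∈
      (𝔭.map (iterateFrobenius R p e)).map (algebraMap R S))
    (hinj : ∀ y : R, algebraMap R S y ∈ (𝔭.map (iterateFrobenius R p e)).map (algebraMap R S) →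
      ∃ c ∉ 𝔭, c * y ∈ 𝔭.map (iterateFrobenius R p e)) :
    ∃ c ∈ factorsBelowIdeal p R e, c ∉ 𝔭 := by
  set J := 𝔭.map (iterateFrobenius R p e) with hJ
  have hmul : ∀ {a b : R}, a ∉ 𝔭 → b ∉ 𝔭 → a * b ∉ 𝔭 := fun ha hb h =>
    (Ideal.IsPrime.mem_or_mem inferInstance h).elim ha hb
  -- Approximate the coefficients of an `S`-linear combination by fractions.
  have key : ∀ h : R → S, h ∈ Submodule.span S {f : R → S | ∃ γ ∈ factorsBelow p R e,
      ∀ x : R, f x = algebraMap R S (toAddHom γ x)} →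
      ∃ u ∉ 𝔭, ∃ γ ∈ factorsBelow p R e, ∀ x : R, algebraMap R S u * h x -
        algebraMap R S (toAddHom γ x) ∈ J.map (algebraMap R S) := by
    intro h hh
    induction hh using Submodule.span_induction with
    | mem h hh =>
      obtain ⟨γ, hγ, hγ'⟩ := hh
      refine ⟨1, fun h => ‹𝔭.IsPrime›.ne_top ((Ideal.eq_top_iff_one _).2 h), γ, hγ, fun x => ?_⟩
      rw [hγ', map_one, one_mul, sub_self]
      exact zero_mem _
    | zero =>
      refine ⟨1, fun h => ‹𝔭.IsPrime›.ne_top ((Ideal.eq_top_iff_one _).2 h), 0, zero_mem _,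
        fun x => ?_⟩
      rw [Pi.zero_apply, mul_zero, toAddHom_zero, map_zero, sub_zero]
      exact zero_mem _
    | add h₁ h₂ _ _ ih₁ ih₂ =>
      obtain ⟨u₁, hu₁, γ₁, hγ₁, ih₁⟩ := ih₁
      obtain ⟨u₂, hu₂, γ₂, hγ₂, ih₂⟩ := ih₂
      refine ⟨u₁ * u₂, hmul hu₁ hu₂, frobeniusRing.mul p e u₂ ∘ₗ γ₁ + frobeniusRing.mul p e u₁ ∘ₗ γ₂,
        add_mem (factorsBelow.mem_comp hγ₁ _) (factorsBelow.mem_comp hγ₂ _), fun x => ?_⟩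
      have h := add_mem (Ideal.mul_mem_left _ (algebraMap R S u₂) (ih₁ x))
        (Ideal.mul_mem_left _ (algebraMap R S u₁) (ih₂ x))
      rw [Pi.add_apply, toAddHom_add, toAddHom_comp, toAddHom_comp, toAddHom_mul, toAddHom_mul,
        map_add, map_mul, map_mul, map_mul]
      convert h using 1
      ring
    | smul s h _ ih =>
      obtain ⟨u, hu, γ, hγ, ih⟩ := ih
      obtain ⟨v, hv, a, ha⟩ := hsurj s
      refine ⟨v * u, hmul hv hu, frobeniusRing.mul p e a ∘ₗ γ, factorsBelow.mem_comp hγ _,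
        fun x => ?_⟩
      have h := add_mem (Ideal.mul_mem_left _ (algebraMap R S v * s) (ih x))
        (Ideal.mul_mem_right (algebraMap R S (toAddHom γ x)) _ ha)
      rw [Pi.smul_apply, smul_eq_mul, toAddHom_comp, toAddHom_mul, map_mul, map_mul]
      convert h using 1
      ring
  obtain ⟨u, hu, γ, hγ, hx⟩ := key _ (factorsBelow.restrict_mem_span hR h1)
  have hc : ∀ x : R, ∃ c ∉ 𝔭, c * (u * x - toAddHom γ x) ∈ J := by
    intro x
    refine hinj _ ?_
    rw [map_sub, map_mul]
    exact hx x
  choose c hc hcJ using hc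
  obtain ⟨X, hX⟩ := (hR.finite e).fg_top
  -- A common denominator for the generators.
  let d : R := ∏ x ∈ X, c x
  have hd : d ∉ 𝔭 := prod_mem (S := 𝔭.primeCompl) fun x _ => hc x
  obtain ⟨q, hqe⟩ : ∃ q, q = p ^ e := ⟨_, rfl⟩
  have hq : q - 1 + 1 = q := Nat.sub_add_cancel (hqe ▸ Nat.one_le_pow _ _ (Fact.out : p.Prime).pos)
  obtain ⟨f, hf⟩ : ∃ f : Module.End R (frobeniusRing p R e),
    f = d • (u • 1 - frobeniusRing.mul p e (u ^ (q - 1)) ∘ₗ γ) := ⟨_, rfl⟩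
  have hfJ : ∀ x : R, c x ∣ d → toAddHom f x ∈ J := by
    rintro x ⟨w, hw⟩
    have h : toAddHom f x = d ^ q * (u ^ q * x - u ^ (q - 1) * toAddHom γ x) := by
      rw [hf, toAddHom_smul, toAddHom_sub, toAddHom_smul, toAddHom_one, toAddHom_comp,
        toAddHom_mul, hqe]
    have h' : d ^ q * (u ^ q * x - u ^ (q - 1) * toAddHom γ x) =
        d ^ (q - 1) * u ^ (q - 1) * w * (c x * (u * x - toAddHom γ x)) := by
      rw [← hq, pow_succ d, pow_succ u, Nat.add_sub_cancel]
      linear_combination d ^ (q - 1) * u ^ (q - 1) * (u * x - toAddHom γ x) * hw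
    rw [h, h']
    exact Ideal.mul_mem_left _ _ (hcJ x)
  refine exists_mem_factorsBelowIdeal_of_range_le (f := f) hR 𝔭 (hmul hd hu) ?_ ?_
  · have hr : LinearMap.range f = Submodule.span R (f '' X) := by
      rw [← Submodule.map_span, hX, LinearMap.range_eq_map]
    rw [hr, Submodule.span_le]
    rintro _ ⟨x, hxX, rfl⟩
    exact mem_smul_top_of_mem_map_iterateFrobenius (hfJ x (Finset.dvd_prod_of_mem c hxX))
  · have h : f - (d * u) • 1 = -(d • (frobeniusRing.mul p e (u ^ (q - 1)) ∘ₗ γ)) := by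
      simp only [hf, smul_sub, smul_smul]
      abel
    rw [h]
    exact neg_mem (Submodule.smul_mem _ _ (factorsBelow.mem_comp hγ _))

end Descent

/-! ### Completed localizations -/

namespace CompletedLocalization

variable {R : Type u} [CommRing R] (𝔭 : Ideal R) [𝔭.IsPrime]

local notation "A" => Localization.AtPrime 𝔭

local notation "𝔪" => IsLocalRing.maximalIdeal (Localization.AtPrime 𝔭)

instance isScalarTower : IsScalarTower R A (CompletedLocalization 𝔭) :=
  IsScalarTower.of_algebraMap_eq fun _ => rfl

instance flat [IsNoetherianRing R] : Module.Flat R (CompletedLocalization 𝔭) :=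
  have : IsNoetherianRing A := IsLocalization.isNoetherianRing 𝔭.primeCompl A inferInstance
  Module.Flat.trans R A (CompletedLocalization 𝔭)

theorem map_maximalIdeal_pow (N : ℕ) : (𝔪 ^ N).map (algebraMap A (CompletedLocalization 𝔭)) =
    (𝔭 ^ N).map (algebraMap R (CompletedLocalization 𝔭)) := by
  have h : 𝔪 ^ N = (𝔭 ^ N).map (algebraMap R A) := by
    rw [Ideal.map_pow, Localization.AtPrime.map_eq_maximalIdeal]
  rw [h, Ideal.map_map, ← IsScalarTower.algebraMap_eq]

variable {𝔭}

/-- Modulo an ideal containing a power of `𝔭`, elements of the completed localization are fractions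
with denominator outside `𝔭`. -/
theorem exists_mul_sub_mem [IsNoetherianRing R] {J : Ideal R} {N : ℕ} (hJ : 𝔭 ^ N ≤ J)
    (s : CompletedLocalization 𝔭) : ∃ u ∉ 𝔭, ∃ a : R,
      algebraMap R (CompletedLocalization 𝔭) u * s - algebraMap R (CompletedLocalization 𝔭) a ∈
        J.map (algebraMap R (CompletedLocalization 𝔭)) := by
  have : IsNoetherianRing A := IsLocalization.isNoetherianRing 𝔭.primeCompl A inferInstance
  obtain ⟨b, hb⟩ := Submodule.Quotient.mk_surjective _ (AdicCompletion.eval 𝔪 A N s)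
  have h₁ : s - algebraMap A (CompletedLocalization 𝔭) b ∈
      J.map (algebraMap R (CompletedLocalization 𝔭)) := by
    refine Ideal.map_mono hJ ?_
    rw [← map_maximalIdeal_pow]
    have h₂ : s - algebraMap A (CompletedLocalization 𝔭) b ∈
        (𝔪 ^ N • ⊤ : Submodule A (CompletedLocalization 𝔭)) := by
      rw [AdicCompletion.pow_smul_top_eq_ker_eval (IsNoetherian.noetherian _), LinearMap.mem_ker,
        map_sub, sub_eq_zero, ← hb]
      rfl
    refine Submodule.smul_induction_on h₂ (fun a ha y _ => ?_) fun x y => add_mem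
    rw [Algebra.smul_def]
    exact Ideal.mul_mem_right _ _ (Ideal.mem_map_of_mem _ ha)
  obtain ⟨a, u, rfl⟩ := IsLocalization.exists_mk'_eq 𝔭.primeCompl b
  refine ⟨u, u.2, a, ?_⟩
  have h₃ := Ideal.mul_mem_left _ (algebraMap R (CompletedLocalization 𝔭) u) h₁
  rw [mul_sub] at h₃
  convert h₃ using 2
  rw [IsScalarTower.algebraMap_apply R A (CompletedLocalization 𝔭) a,
    IsScalarTower.algebraMap_apply R A (CompletedLocalization 𝔭) u, ← map_mul,
    IsLocalization.mk'_spec']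

/-- An ideal containing a power of `𝔭` is contracted from the completed localization, up to
multiplication by elements outside `𝔭`. -/
theorem exists_mul_mem {J : Ideal R} {N : ℕ} (hJ : 𝔭 ^ N ≤ J) {y : R}
    (hy : algebraMap R (CompletedLocalization 𝔭) y ∈
      J.map (algebraMap R (CompletedLocalization 𝔭))) : ∃ c ∉ 𝔭, c * y ∈ J := by
  have h₁ := Ideal.mem_map_of_mem (AdicCompletion.evalₐ 𝔪 N).toRingHom hy
  rw [Ideal.map_map] at h₁
  have h₂ : (AdicCompletion.evalₐ 𝔪 N).toRingHom.comp (algebraMap R (CompletedLocalization 𝔭)) =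
      (Ideal.Quotient.mk (𝔪 ^ N)).comp (algebraMap R A) := by
    ext r
    exact (AdicCompletion.evalₐ 𝔪 N).commutes (algebraMap R A r)
  rw [h₂, ← RingHom.comp_apply, h₂, RingHom.comp_apply, ← Ideal.map_map, ← Ideal.mem_comap,
    Ideal.comap_map_of_surjective _ Ideal.Quotient.mk_surjective, ← RingHom.ker,
    Ideal.mk_ker] at h₁
  have h₃ : 𝔪 ^ N ≤ J.map (algebraMap R A) := by
    rw [← Localization.AtPrime.map_eq_maximalIdeal, ← Ideal.map_pow]
    exact Ideal.map_mono hJ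
  rw [sup_eq_left.2 h₃, IsLocalization.algebraMap_mem_map_algebraMap_iff 𝔭.primeCompl] at h₁
  obtain ⟨c, hc, h⟩ := h₁
  exact ⟨c, hc, h⟩

end CompletedLocalization

/-- The ideals `factorsBelowIdeal p R e` increase with `e`, and none of the primes contains all of
them. -/
theorem HasCLFFRT.exists_factorsBelowIdeal_eq_top {p : ℕ} [Fact p.Prime] {R : Type u} [CommRing R]
    [CharP R p] (hR : HasCLFFRT p R) : ∃ e, factorsBelowIdeal p R e = ⊤ := by
  have := hR.isFFinite.isNoetherianRing
  obtain ⟨e, he⟩ := monotone_stabilizes_iff_noetherian.2 this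
    ⟨factorsBelowIdeal p R, monotone_factorsBelowIdeal⟩
  refine ⟨e, ?_⟩
  by_contra hne
  obtain ⟨𝔭, h𝔭, hle⟩ := Ideal.exists_le_maximal _ hne
  have := h𝔭.isPrime
  obtain ⟨k, hk⟩ := (hR.hasFFRT 𝔭).exists_one_mem_factorsBelow
  obtain ⟨N, hN⟩ := hR.isFFinite.exists_pow_le_map 𝔭 k 1
  rw [pow_one] at hN
  obtain ⟨c, hc, hc𝔭⟩ := exists_mem_factorsBelowIdeal hR.isFFinite hk 𝔭
    (CompletedLocalization.exists_mul_sub_mem hN) fun y => CompletedLocalization.exists_mul_mem hN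
  have h₁ := monotone_factorsBelowIdeal (le_max_right e k) hc
  exact hc𝔭 (hle ((he _ (le_max_left e k)).ge h₁))

/-! ### Finiteness of associated primes -/

section AssociatedPrimes

variable {p : ℕ} [Fact p.Prime] {R : Type u} [CommRing R] [CharP R p]

/-- If each `H(α) v`, with `α` a map to some `F^{e'}_* R` with `e' < e`, is killed by an element outside
`P`, then so is `H(g) v` for each sum `g` of maps factoring through such `F^{e'}_* R`. -/
theorem exists_notMem_smul_map_eq_zero {H : ModuleCat.{u} R ⥤ ModuleCat.{u} R} [H.Additive]
    [H.Linear R] {P : Ideal R} [P.IsPrime] {e : ℕ} {v : H.obj (frobeniusRing p R e)}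
    (hv : ∀ e' < e, ∀ α : frobeniusRing p R e ⟶ frobeniusRing p R e', ∃ c ∉ P,
      c • (H.map α).hom v = 0)
    {g : Module.End R (frobeniusRing p R e)} (hg : g ∈ factorsBelow p R e) :
    ∃ c ∉ P, c • (H.map (ConcreteCategory.ofHom g :
      frobeniusRing p R e ⟶ frobeniusRing p R e)).hom v = 0 := by
  induction hg using Submodule.span_induction with
  | mem g hg =>
    obtain ⟨e', he', α, β, rfl⟩ := hg
    let a : frobeniusRing p R e ⟶ frobeniusRing p R e' := ConcreteCategory.ofHom α
    let b : frobeniusRing p R e' ⟶ frobeniusRing p R e := ConcreteCategory.ofHom β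
    obtain ⟨c, hc, h⟩ := hv e' he' a
    refine ⟨c, hc, ?_⟩
    change c • (H.map (a ≫ b)).hom v = 0
    rw [H.map_comp, ModuleCat.hom_comp, LinearMap.comp_apply, ← map_smul, h, map_zero]
  | zero =>
    refine ⟨1, fun h => ‹P.IsPrime›.ne_top ((Ideal.eq_top_iff_one _).2 h), ?_⟩
    change (1 : R) • (H.map (0 : frobeniusRing p R e ⟶ frobeniusRing p R e)).hom v = 0
    rw [H.map_zero, one_smul]
    rfl
  | add f g _ _ hf hg =>
    obtain ⟨c, hc, hcf⟩ := hf
    obtain ⟨d, hd, hdg⟩ := hg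
    let a : frobeniusRing p R e ⟶ frobeniusRing p R e := ConcreteCategory.ofHom f
    let b : frobeniusRing p R e ⟶ frobeniusRing p R e := ConcreteCategory.ofHom g
    refine ⟨c * d, fun h => (Ideal.IsPrime.mem_or_mem inferInstance h).elim hc hd, ?_⟩
    change (c * d) • (H.map (a + b)).hom v = 0
    rw [H.map_add, ModuleCat.hom_add, LinearMap.add_apply, smul_add, mul_smul c d ((H.map b).hom v),
      hdg, mul_comm, mul_smul, hcf, smul_zero, smul_zero, add_zero]
  | smul r g _ hg =>
    obtain ⟨c, hc, h⟩ := hg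
    let a : frobeniusRing p R e ⟶ frobeniusRing p R e := ConcreteCategory.ofHom g
    refine ⟨c, hc, ?_⟩
    change c • (H.map (r • a)).hom v = 0
    rw [H.map_smul, ModuleCat.hom_smul, LinearMap.smul_apply, smul_comm, h, smul_zero]

namespace FrobeniusApproximation

variable {H : ModuleCat.{u} R ⥤ ModuleCat.{u} R} [H.Additive] [H.Linear R]

/-- When `F^e_* R` is additively generated by Frobenius pushforwards of smaller exponent for `e = n`,
a prime annihilator of an element of some `T (F^e_* R)` already occurs for an exponent below `n`. -/
theorem exists_mem_associatedPrimes [IsNoetherianRing R] (A : FrobeniusApproximation p H) {n : ℕ}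
    (hn : factorsBelowIdeal p R n = ⊤) {P : Ideal R} [hP : P.IsPrime] (e : ℕ)
    {v : H.obj (frobeniusRing p R e)} (hvT : v ∈ A.T (frobeniusRing p R e))
    (hv : ∀ r : R, r ∈ P ↔ r • v = 0) :
    ∃ k < n, P ∈ associatedPrimes R (A.T (frobeniusRing p R k)) := by
  induction e using Nat.strong_induction_on with
  | _ e ih =>
    rcases lt_or_ge e n with he | he
    · refine ⟨e, he, isAssociatedPrime_iff.2 ⟨hP, ⟨v, hvT⟩, ?_⟩⟩
      ext r
      rw [Submodule.mem_colon_singleton, Submodule.mem_bot, hv, ← Submodule.coe_eq_zero]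
      rfl
    · have h1 : (1 : Module.End R (frobeniusRing p R e)) ∈ factorsBelow p R e := by
        have h := monotone_factorsBelowIdeal he (hn ▸ Submodule.mem_top : (1 : R) ∈ _)
        rwa [mem_factorsBelowIdeal, one_smul] at h
      by_contra hcon
      obtain ⟨c, hc, hcv⟩ := exists_notMem_smul_map_eq_zero (H := H) (P := P) (v := v)
        (fun e' he' α => by
          by_contra! hα
          refine hcon (ih e' he' (A.map_mem α hvT) fun r => ⟨fun hr => ?_, fun hr => ?_⟩)
          · rw [← map_smul, (hv r).1 hr, map_zero]
          · by_contra hrP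
            exact hα r hrP hr) h1
      refine hc ((hv c).2 ?_)
      change c • (H.map (𝟙 (frobeniusRing p R e))).hom v = 0 at hcv
      rw [H.map_id] at hcv
      exact hcv

/-- The annihilator of `u ∈ H R` is not changed by the passage to `T (F^e_* R)`, so that associated
primes of `H R` occur in the finite modules `T (F^k_* R)` with `k < n`. -/
theorem finite_associatedPrimes (A : FrobeniusApproximation p H) (hR : IsFFinite p R) {n : ℕ}
    (hn : factorsBelowIdeal p R n = ⊤) :
    (associatedPrimes R (H.obj (ModuleCat.of R R))).Finite := by
  have := hR.isNoetherianRing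
  refine Set.Finite.subset (Set.Finite.biUnion (Set.finite_lt_nat n)
    (t := fun k => associatedPrimes R (A.T (frobeniusRing p R k))) fun k _ => ?_) ?_
  · have := hR.finite k
    have := A.finite (frobeniusRing p R k)
    exact associatedPrimes.finite R _
  · intro P hP
    obtain ⟨hPp, u, hu⟩ := isAssociatedPrime_iff.1 hP
    obtain ⟨e, he⟩ := (A.eventually_mem _ u).exists
    have hu' : ∀ r, r ∈ P ↔ r • u = 0 := fun r => by
      rw [hu, Submodule.mem_colon_singleton, Submodule.mem_bot]
    obtain ⟨k, hk, hPk⟩ := A.exists_mem_associatedPrimes hn e he fun r => by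
      have hpe : p ^ e ≠ 0 := pow_ne_zero _ (Fact.out : p.Prime).ne_zero
      have h := map_eq_zero_iff (A.φ e (ModuleCat.of R R)).hom (A.bijective e _).injective
        (x := (r ^ p ^ e • u : H.obj (ModuleCat.of R R)))
      refine ((Ideal.IsPrime.pow_mem_iff_mem hPp _ (Nat.pos_of_ne_zero hpe)).symm.trans
        ((hu' (r ^ p ^ e)).trans h.symm)).trans ?_
      exact Eq.congr_left ((A.φ e (ModuleCat.of R R)).hom.map_smul r u)
    exact Set.mem_biUnion hk hPk

end FrobeniusApproximation

end AssociatedPrimes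

theorem mainTheorem1 (p : ℕ) [Fact p.Prime] (R : Type u) [CommRing R] [CharP R p]
    (hR : HasCLFFRT p R) (L : List (Ideal R × ℕ)) :
    (associatedPrimes R
      ((iteratedLocalCohomology L).obj (ModuleCat.of R R) : ModuleCat.{u} R)).Finite := by
  have := hR.isFFinite.isNoetherianRing
  obtain ⟨n, hn⟩ := hR.exists_factorsBelowIdeal_eq_top
  obtain ⟨A⟩ := hR.isFFinite.nonempty_frobeniusApproximation L
  exact A.finite_associatedPrimes hR.isFFinite hn
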